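/- Let $\mathbb{N}=\{1,2,\dots\}$. A function $f:\mathbb{N}\to\mathbb{Z}$ is called a \emph{PIO function} (polynomial in input and output) if there are a multitape Turing machine and constants $c,d\in\mathbb{N}$ such that for every $n\in\mathbb{N}$ the machine, given $n$ in binary, outputs $f(n)$ in binary (with a sign) in at most $c\cdot m_f(n)^d$ steps, where $$m_f(n)=\log(1+n)+\log(2+|f(n)|).$$ Let $Q(n)$ be the set of partitions of $n$ into distinct parts, let $\|\lambda\|$ denote the number of parts of a partition $\lambda$, and let $q_k(n)$ be the number of $\lambda\in Q(n)$ with $\|\lambda\|=k$. (1) If $g:\mathbb{N}\to\mathbb{N}$ is a PIO function, then the function $f:\mathbb{N}\to\mathbb{N}$, $$f(n)=\sum_{\lambda\in Q(n)}g(\|\lambda\|),$$ is a PIO function. (2) For $n\in\mathbb{N}$ let $f_{cdp}(n)$ be the number of compositions of $n$ with no part repeated, that is, of tuples $(c_1,\dots,c_k)$ of pairwise distinct positive integers, $k\ge1$, with $c_1+\dots+c_k=n$. Then $$f_{cdp}(n)=\sum_{k=1}^n k!\,q_k(n)\quad\text{for every } n\in\mathbb{N},$$ and $f_{cdp}$ is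 a PIO function. -/

import Mathlib

open Turing Computability

/-- Binary code of an integer: a sign bit (`true` for negative numbers), followed by the binary
digits of the absolute value, least significant digit first. -/
def encodeInt (z : ℤ) : List Bool :=
  decide (z < 0) :: encodeNat z.natAbs

/-- The machine `M` (a Turing machine with finitely many stacks, finitely many labels and finitely
many internal states, whose input and output alphabets are identified with `Bool`), started on the
word `x`, halts with the word `y` as output after at most `t` steps. -/
def OutputsWithin (M : TM2ComputableAux Bool Bool) (x y : List Bool) (t : ℕ) : Prop :=
  Nonempty (TM2OutputsInTime M.tm (x.map M.inputAlphabet.symm)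
    (some (y.map M.outputAlphabet.symm)) t)

/-- The combined input and output size `m_f(n) = log (1 + n) + log (2 + |f n|)`. -/
noncomputable def inOutSize (f : ℕ → ℤ) (n : ℕ) : ℝ :=
  Real.log (1 + (n : ℝ)) + Real.log (2 + |(f n : ℝ)|)

/-- `M` is a PIO algorithm for the counting function `f`, defined on the positive integers: for
some positive integers `c` and `d`, on the binary code of every `n ≥ 1` it computes the binary code
of `f n` in at most `c * m_f(n) ^ d` steps. The value `f 0` plays no role. -/
def IsPIOAlgorithm (M : TM2ComputableAux Bool Bool) (f : ℕ → ℤ) : Prop :=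
  ∃ c d : ℕ, 0 < c ∧ 0 < d ∧ ∀ n : ℕ, 1 ≤ n →
    ∃ t : ℕ, (t : ℝ) ≤ c * inOutSize f n ^ d ∧
      OutputsWithin M (encodeNat n) (encodeInt (f n)) t

/-- A function on the positive integers is a PIO function if it has a PIO algorithm. -/
def IsPIO (f : ℕ → ℤ) : Prop :=
  ∃ M : TM2ComputableAux Bool Bool, IsPIOAlgorithm M f

/-- `∑_{λ ∈ Q(n)} g(‖λ‖)`: sum over the partitions of `n` into distinct parts of the values of `g`
at the number of parts. -/
def distinctPartsSum (g : ℕ → ℕ) (n : ℕ) : ℕ :=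
  ∑ p ∈ Nat.Partition.distincts n, g p.parts.card

/-- `q_k(n)`: the number of partitions of `n` into exactly `k` distinct parts. -/
def numDistinctPartitions (k n : ℕ) : ℕ :=
  ((Nat.Partition.distincts n).filter fun p => p.parts.card = k).card

/-- The number of compositions of `n` with no part repeated. -/
def numDistinctCompositions (n : ℕ) : ℕ :=
  (Finset.univ.filter fun c : Composition n => c.blocks.Nodup).card

/-! ### Program fragments of stack machines -/

/-! Write f(n) for the sum over Q(n). The time allowed is polynomial in log f(n), and this is
generous because f(n) is large. As g ≥ 1, f(n) is at least the number of partitions of n into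
distinct parts. Every subset of {1,…,r} with (r+1)² ≤ n becomes such a partition after adding one
large part. Hence f(n) ≥ 2^(⌊√n⌋-1), so n < (log₂ f(n) + 2)² (`lt_of_distinctPartsSum`), and time
polynomial in n is affordable, even with counters in unary.

All q_k(n) are read off a single integer by Kronecker substitution. In ∏_{i≤n} (1 + y xⁱ) the
coefficient of y^k x^n is q_k(n). Put y = X = 2^(n+1) and x = X^(n+1), so that a subset s of {1,…,n}
contributes X^(#s + (n+1)∑s). There are 2^n < X subsets, so the base-X digits do not carry; as #s ≤
n, the exponent determines both #s and ∑s. Thus q_k(n) is the base-X digit at position k + (n+1)n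
(`prod_div_mod`). The product has polynomially many bits and is built by shifts and additions.

It remains to add up g(k) q_k(n). When q_k(n) = 0, g(k) may be far larger than f(n), so the
algorithm for g is called only if q_k(n) ≠ 0. Then k ≤ n and g(k) ≤ f(n), which makes m_g(k), and
with it the time of the call, polynomial in log f(n) (`inOutSize_le`).

A partition into k distinct parts has k! orderings, so f_cdp is the case g(k) = k!. The factorial is
PIO because k! ≥ 2^(k-1) makes time polynomial in k affordable (`isPIO_factorial`).

The machines are assembled from program fragments. `Runs` records the effect of a fragment on the
registers together with a time bound, and `callReversed` turns a given machine into a subroutine. -/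

namespace StackProgram

open TM2.Stmt

section Relabel

variable {K : Type} {Γ : K → Type} {σ : Type}

/-- Rename the labels of a statement. -/
def relabel {Λ Λ' : Type} (f : Λ → Λ') : TM2.Stmt Γ Λ σ → TM2.Stmt Γ Λ' σ
  | push k g q => push k g (relabel f q)
  | peek k g q => peek k g (relabel f q)
  | pop k g q => pop k g (relabel f q)
  | load g q => load g (relabel f q)
  | branch p q₁ q₂ => branch p (relabel f q₁) (relabel f q₂)
  | goto l => goto fun v => f (l v)
  | halt => halt

theorem stepAux_relabel [DecidableEq K] {Λ Λ' : Type} (f : Λ → Λ') (q : TM2.Stmt Γ Λ σ) (v : σ)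
    (S : ∀ k, List (Γ k)) :
    TM2.stepAux (relabel f q) v S =
      ⟨(TM2.stepAux q v S).l.map f, (TM2.stepAux q v S).var, (TM2.stepAux q v S).stk⟩ := by
  induction q generalizing v S with
  | branch p q₁ q₂ h₁ h₂ => simp only [relabel, TM2.stepAux]; cases p v <;> simp [h₁, h₂]
  | goto l => rfl
  | halt => rfl
  | _ => simp_all [relabel, TM2.stepAux]

/-- A piece of a stack machine: finitely many labels, where a jump to `none` leaves the piece. -/
structure Fragment (Γ : K → Type) (σ : Type) where
  /-- labels -/
  Λ : Type
  /-- there are finitely many labels -/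
  fin : Fintype Λ
  /-- the label where the execution starts -/
  entry : Λ
  /-- the statements -/
  code : Λ → TM2.Stmt Γ (Option Λ) σ

/-- Started at a given label, the code leaves after exactly the given number of steps. -/
inductive Reach [DecidableEq K] {Λ : Type} (code : Λ → TM2.Stmt Γ (Option Λ) σ) :
    Λ → σ → (∀ k, List (Γ k)) → ℕ → σ → (∀ k, List (Γ k)) → Prop
  | exit {l v S v' S'} (h : TM2.stepAux (code l) v S = ⟨some none, v', S'⟩) :
      Reach code l v S 1 v' S'
  | step {l v S l₁ v₁ S₁ t v' S'} (h : TM2.stepAux (code l) v S = ⟨some (some l₁), v₁, S₁⟩)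
      (h' : Reach code l₁ v₁ S₁ t v' S') : Reach code l v S (t + 1) v' S'

variable [DecidableEq K] {Λ₁ Λ : Type} {code₁ : Λ₁ → TM2.Stmt Γ (Option Λ₁) σ}
  {code : Λ → TM2.Stmt Γ (Option Λ) σ}

/-- Code embedded into larger code, its exit being an exit of the larger code. -/
theorem Reach.embed (ψ : Λ₁ → Λ) (φ : Option Λ₁ → Option Λ)
    (hcode : ∀ l, code (ψ l) = relabel φ (code₁ l)) (hφ : ∀ l, φ (some l) = some (ψ l))
    (hn : φ none = none) {l v S t v' S'} (h : Reach code₁ l v S t v' S') :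
    Reach code (ψ l) v S t v' S' := by
  induction h with
  | exit h => exact .exit (by rw [hcode, stepAux_relabel, h]; simp [hn])
  | step h _ ih => exact .step (by rw [hcode, stepAux_relabel, h]; simp [hφ]) ih

/-- Code embedded into larger code, its exit being a jump to some label of the larger code. -/
theorem Reach.embed_trans (ψ : Λ₁ → Λ) (φ : Option Λ₁ → Option Λ)
    (hcode : ∀ l, code (ψ l) = relabel φ (code₁ l)) (hφ : ∀ l, φ (some l) = some (ψ l))
    {l₂ : Λ} (hn : φ none = some l₂) {l v S t v' S'} (h : Reach code₁ l v S t v' S')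
    {t₂ v'' S''} (h₂ : Reach code l₂ v' S' t₂ v'' S'') :
    Reach code (ψ l) v S (t + t₂) v'' S'' := by
  induction h with
  | exit h =>
    rw [add_comm]
    exact .step (by rw [hcode, stepAux_relabel, h]; simp [hn]) h₂
  | step h _ ih =>
    rw [add_right_comm]
    exact .step (by rw [hcode, stepAux_relabel, h]; simp [hφ]) (ih h₂)

end Relabel

/-! ### Programs on registers: sequencing, case distinction, loops -/

section Registers

variable (M : TM2ComputableAux Bool Bool) (R : Type)

/-- The stacks of a machine that owns registers in `R` and may call the machine `M`. -/
abbrev Key : Type := M.tm.K ⊕ R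

/-- The alphabets of the stacks. -/
abbrev Alphabet : Key M R → Type := Sum.elim M.tm.Γ fun _ => Bool

/-- The internal states: that of `M`, and two symbols that were read. -/
abbrev Internal : Type := M.tm.σ × Option Bool × Option Bool

/-- Programs working on the registers `R` that may call the machine `M`. -/
abbrev Prog : Type 1 := Fragment (Alphabet M R) (Internal M)

variable {M R}

/-- The stacks, given by the stacks of `M` and the registers. -/
def toStacks (a : ∀ k, List (M.tm.Γ k)) (s : R → List Bool) : ∀ k, List (Alphabet M R k)
  | .inl k => a k
  | .inr r => s r

@[simp] theorem toStacks_inl (a : ∀ k, List (M.tm.Γ k)) (s : R → List Bool) (k : M.tm.K) :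
    toStacks a s (.inl k) = a k := rfl

@[simp] theorem toStacks_inr (a : ∀ k, List (M.tm.Γ k)) (s : R → List Bool) (r : R) :
    toStacks a s (.inr r) = s r := rfl

variable [DecidableEq R]

instance : DecidableEq (Key M R) := instDecidableEqSum

@[simp] theorem update_toStacks_inr (a : ∀ k, List (M.tm.Γ k)) (s : R → List Bool) (r : R)
    (x : List Bool) :
    Function.update (toStacks a s) (.inr r) x = toStacks a (Function.update s r x) := by
  funext k
  rcases k with k | k
  · simp [Function.update]
  · by_cases h : k = r
    · subst h
      exact (Function.update_self ..).trans (by simp [toStacks])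
    · exact (Function.update_of_ne (by simpa using h) ..).trans (by simp [toStacks, h])

@[simp] theorem update_toStacks_inl (a : ∀ k, List (M.tm.Γ k)) (s : R → List Bool) (r : M.tm.K)
    (x : List (M.tm.Γ r)) :
    Function.update (toStacks a s) (.inl r) x = toStacks (Function.update a r x) s := by
  funext k
  rcases k with k | k
  · by_cases h : k = r
    · subst h
      exact (Function.update_self ..).trans (by simp [toStacks])
    · exact (Function.update_of_ne (by simpa using h) ..).trans (by simp [toStacks, h])
  · simp [Function.update]

/-- Started with the registers `s` and all stacks of `M` empty, the program ends with the registers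
`s'` and all stacks of `M` empty, after at most `t` steps. -/
def Runs (p : Prog M R) (s s' : R → List Bool) (t : ℕ) : Prop :=
  -- Fragments leave arbitrary internal states behind, so a run must be guaranteed from every
  -- internal state for composition to work.
  ∀ v, ∃ v', ∃ t' ≤ t,
    Reach p.code p.entry v (toStacks (fun _ => []) s) t' v' (toStacks (fun _ => []) s')

theorem Runs.mono {p : Prog M R} {s s' s'' : R → List Bool} {t t' : ℕ} (h : Runs p s s' t)
    (hs : s' = s'') (ht : t ≤ t') : Runs p s s'' t' := by
  subst hs
  intro v
  obtain ⟨v', u, hu, h⟩ := h v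
  exact ⟨v', u, hu.trans ht, h⟩

/-- The program that does nothing. -/
def skip : Prog M R where
  Λ := Unit
  fin := inferInstance
  entry := ()
  code _ := goto fun _ => none

theorem runs_skip (s : R → List Bool) : Runs (skip : Prog M R) s s 1 :=
  fun v => ⟨v, 1, le_rfl, .exit rfl⟩

/-- Push a bit on a register. -/
def push (r : R) (b : Bool) : Prog M R where
  Λ := Unit
  fin := inferInstance
  entry := ()
  code _ := TM2.Stmt.push (.inr r) (fun _ => b) (goto fun _ => none)

theorem runs_push (r : R) (b : Bool) (s : R → List Bool) :
    Runs (push r b : Prog M R) s (Function.update s r (b :: s r)) 1 := by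
  refine fun v => ⟨v, 1, le_rfl, .exit ?_⟩
  simp only [push, TM2.stepAux]
  erw [update_toStacks_inr]
  rfl

/-- One program after the other. -/
def seq (p q : Prog M R) : Prog M R where
  Λ := p.Λ ⊕ q.Λ
  fin := letI := p.fin; letI := q.fin; inferInstance
  entry := .inl p.entry
  code
    | .inl l => relabel (fun o => some (o.elim (.inr q.entry) .inl)) (p.code l)
    | .inr l => relabel (Option.map .inr) (q.code l)

/-- One program after the other. -/
infixr:60 " ;; " => seq

theorem Runs.seq {p q : Prog M R} {s s' s'' : R → List Bool} {t t' : ℕ} (h : Runs p s s' t)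
    (h' : Runs q s' s'' t') : Runs (p ;; q) s s'' (t + t') := by
  intro v
  obtain ⟨v', u, hu, h⟩ := h v
  obtain ⟨v'', u', hu', h'⟩ := h' v'
  refine ⟨v'', u + u', add_le_add hu hu', ?_⟩
  refine Reach.embed_trans (code := (p ;; q).code) Sum.inl _ (fun _ => rfl) (fun _ => rfl) rfl h ?_
  exact Reach.embed (code := (p ;; q).code) Sum.inr _ (fun _ => rfl) (fun _ => rfl) rfl h'

/-- Pop a register, and continue according to the outcome. -/
def popCases (r : R) (p p₀ p₁ : Prog M R) : Prog M R where
  Λ := Option (p.Λ ⊕ p₀.Λ ⊕ p₁.Λ)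
  fin := letI := p.fin; letI := p₀.fin; letI := p₁.fin; inferInstance
  entry := none
  code
    | none => pop (.inr r) (fun v o => (v.1, o, none)) <| goto fun v => some <| some <|
        match v.2.1 with
        | none => .inl p.entry
        | some false => .inr (.inl p₀.entry)
        | some true => .inr (.inr p₁.entry)
    | some (.inl l) => relabel (Option.map (some ∘ .inl)) (p.code l)
    | some (.inr (.inl l)) => relabel (Option.map (some ∘ .inr ∘ .inl)) (p₀.code l)
    | some (.inr (.inr l)) => relabel (Option.map (some ∘ .inr ∘ .inr)) (p₁.code l)

theorem stepAux_pop_goto {Λ : Type} (r : R) (f : Internal M → Λ) (v : Internal M)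
    (s : R → List Bool) :
    TM2.stepAux (Γ := Alphabet M R)
      (pop (.inr r) (fun v (o : Option Bool) => (v.1, o, none)) (goto f)) v
      (toStacks (fun _ => []) s) =
    ⟨some (f (v.1, (s r).head?, none)), (v.1, (s r).head?, none),
      toStacks (fun _ => []) (Function.update s r (s r).tail)⟩ := by
  simp only [TM2.stepAux]
  erw [update_toStacks_inr]
  rfl

theorem runs_popCases_nil {r : R} {p p₀ p₁ : Prog M R} {s s' : R → List Bool} {t : ℕ}
    (hr : s r = []) (h : Runs p s s' t) : Runs (popCases r p p₀ p₁) s s' (t + 1) := by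
  intro v
  obtain ⟨v', u, hu, h⟩ := h (v.1, none, none)
  refine ⟨v', u + 1, by omega, .step ((stepAux_pop_goto _ _ _ _).trans ?_)
    (Reach.embed (code := (popCases r p p₀ p₁).code) (some ∘ Sum.inl) _
      (fun _ => rfl) (fun _ => rfl) rfl h)⟩
  have : Function.update s r [] = s := by rw [← hr, Function.update_eq_self]
  simp [hr, this]
  rfl

theorem runs_popCases_cons {r : R} {p p₀ p₁ : Prog M R} {s s' : R → List Bool} {t : ℕ} (b : Bool)
    {x : List Bool} (hr : s r = b :: x)
    (h : Runs (if b then p₁ else p₀) (Function.update s r x) s' t) :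
    Runs (popCases r p p₀ p₁) s s' (t + 1) := by
  intro v
  obtain ⟨v', u, hu, h⟩ := h (v.1, some b, none)
  refine ⟨v', u + 1, by omega, ?_⟩
  cases b
  · refine .step ((stepAux_pop_goto _ _ _ _).trans ?_)
      (Reach.embed (code := (popCases r p p₀ p₁).code) (some ∘ Sum.inr ∘ Sum.inl) _
        (fun _ => rfl) (fun _ => rfl) rfl h)
    simp [hr]
    rfl
  · refine .step ((stepAux_pop_goto _ _ _ _).trans ?_)
      (Reach.embed (code := (popCases r p p₀ p₁).code) (some ∘ Sum.inr ∘ Sum.inr) _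
        (fun _ => rfl) (fun _ => rfl) rfl h)
    simp [hr]
    rfl

/-- As long as a register is not empty, pop it and continue according to the symbol. -/
def loop (r : R) (p₀ p₁ : Prog M R) : Prog M R where
  Λ := Option (p₀.Λ ⊕ p₁.Λ)
  fin := letI := p₀.fin; letI := p₁.fin; inferInstance
  entry := none
  code
    | none => pop (.inr r) (fun v o => (v.1, o, none)) <| goto fun v =>
        match v.2.1 with
        | none => none
        | some false => some (some (.inl p₀.entry))
        | some true => some (some (.inr p₁.entry))
    | some (.inl l) => relabel (fun o => some (o.map .inl)) (p₀.code l)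
    | some (.inr l) => relabel (fun o => some (o.map .inr)) (p₁.code l)

theorem runs_loop_nil {r : R} {p₀ p₁ : Prog M R} {s : R → List Bool} (hr : s r = []) :
    Runs (loop r p₀ p₁) s s 1 := by
  intro v
  refine ⟨(v.1, none, none), 1, le_rfl, .exit ((stepAux_pop_goto _ _ _ _).trans ?_)⟩
  have : Function.update s r [] = s := by rw [← hr, Function.update_eq_self]
  simp [hr, this]
  rfl

theorem runs_loop_cons {r : R} {p₀ p₁ : Prog M R} {s s' s'' : R → List Bool} {t t' : ℕ} (b : Bool)
    {x : List Bool} (hr : s r = b :: x)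
    (h : Runs (if b then p₁ else p₀) (Function.update s r x) s' t)
    (h' : Runs (loop r p₀ p₁) s' s'' t') : Runs (loop r p₀ p₁) s s'' (t + 1 + t') := by
  intro v
  obtain ⟨v', u, hu, h⟩ := h (v.1, some b, none)
  obtain ⟨v'', u', hu', h'⟩ := h' v'
  refine ⟨v'', u + u' + 1, by omega, ?_⟩
  cases b
  · refine .step ((stepAux_pop_goto _ _ _ _).trans ?_)
      (Reach.embed_trans (code := (loop r p₀ p₁).code) (some ∘ Sum.inl) _
        (fun _ => rfl) (fun _ => rfl) rfl h h')
    simp [hr]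
    rfl
  · refine .step ((stepAux_pop_goto _ _ _ _).trans ?_)
      (Reach.embed_trans (code := (loop r p₀ p₁).code) (some ∘ Sum.inr) _
        (fun _ => rfl) (fun _ => rfl) rfl h h')
    simp [hr]
    rfl

/-- A loop along a family of states. -/
theorem runs_loop {r : R} {p₀ p₁ : Prog M R} (t : ℕ) (m : ℕ) (I : ℕ → R → List Bool)
    (hm : I m r = [])
    (h : ∀ i < m, ∃ b x, I i r = b :: x ∧
      Runs (if b then p₁ else p₀) (Function.update (I i) r x) (I (i + 1)) t) :
    Runs (loop r p₀ p₁) (I 0) (I m) (m * (t + 1) + 1) := by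
  induction m generalizing I with
  | zero => exact (runs_loop_nil hm).mono rfl (by omega)
  | succ m ih =>
    obtain ⟨b, x, hb, hrun⟩ := h 0 (by omega)
    refine (runs_loop_cons b hb hrun
      (ih (fun i => I (i + 1)) hm fun i hi => h (i + 1) (by omega))).mono rfl ?_
    ring_nf; omega

end Registers

open TM2.Stmt

/-! ### Calling a given machine as a subroutine -/

section Call

variable {M : TM2ComputableAux Bool Bool} {R : Type}

/-- A statement of `M`, as part of a larger program; the label `none` is the end of `M`. -/
def liftStmt : TM2.Stmt M.tm.Γ M.tm.Λ M.tm.σ →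
    TM2.Stmt (Alphabet M R) (Option (Option (Option M.tm.Λ))) (Internal M)
  | .push k g q => .push (.inl k) (fun v => g v.1) (liftStmt q)
  | peek k g q => peek (.inl k) (fun v o => (g v.1 o, v.2)) (liftStmt q)
  | pop k g q => pop (.inl k) (fun v o => (g v.1 o, v.2)) (liftStmt q)
  | load g q => load (fun v => (g v.1, v.2)) (liftStmt q)
  | branch p q₁ q₂ => branch (fun v => p v.1) (liftStmt q₁) (liftStmt q₂)
  | goto l => goto fun v => some (some (some (l v.1)))
  | halt => goto fun _ => some (some none)

variable [DecidableEq R]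

/-- The lifted code simulates `M` step by step on its own stacks and never touches the registers or
the two read symbols. Where `M` halts, it jumps to `some none`, the label that moves the output. -/
theorem stepAux_liftStmt (q : TM2.Stmt M.tm.Γ M.tm.Λ M.tm.σ) (v : M.tm.σ)
    (w : Option Bool × Option Bool) (a : ∀ k, List (M.tm.Γ k)) (s : R → List Bool) :
    TM2.stepAux (liftStmt (R := R) q) (v, w) (toStacks a s) =
      ⟨some (some (some (TM2.stepAux q v a).l)), ((TM2.stepAux q v a).var, w),
        toStacks (TM2.stepAux q v a).stk s⟩ := by
  induction q generalizing v a with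
  | push k g q ih =>
    simp only [liftStmt, TM2.stepAux]
    erw [update_toStacks_inl, ih]
    rfl
  | pop k g q ih =>
    simp only [liftStmt, TM2.stepAux]
    erw [update_toStacks_inl, ih]
    rfl
  | peek k g q ih => exact ih _ _
  | load g q ih => exact ih _ _
  | branch p q₁ q₂ h₁ h₂ => simp only [liftStmt, TM2.stepAux]; cases p v <;> simp [h₁, h₂]
  | goto l => rfl
  | halt => rfl

/-- Move the register `x` to the input stack of `M`, run `M`, and move its output to the register
`y`. Both moves reverse the order of the symbols. -/
def callReversed (x y : R) : Prog M R where
  Λ := Option (Option M.tm.Λ)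
  fin := letI := M.tm.ΛFin; inferInstance
  entry := none
  code
    | none => pop (.inr x) (fun v o => (v.1, o, none)) <| branch (fun v => v.2.1.isSome)
        (TM2.Stmt.push (.inl M.tm.k₀) (fun v => M.inputAlphabet.symm (v.2.1.getD false))
          (goto fun _ => some none))
        (load (fun v => (M.tm.initialState, v.2)) (goto fun _ => some (some (some M.tm.main))))
    | some (some l) => liftStmt (M.tm.m l)
    | some none => pop (.inl M.tm.k₁) (fun v o => (v.1, o.map M.outputAlphabet, none)) <|
        branch (fun v => v.2.1.isSome)
          (TM2.Stmt.push (.inr y) (fun v => v.2.1.getD false) (goto fun _ => some (some none)))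
          (goto fun _ => none)

theorem reach_callReversed_output (x y : R) (s : R → List Bool) (z : List (M.tm.Γ M.tm.k₁)) (v) :
    ∃ v', Reach (callReversed x y).code (some none) v
      (toStacks (Function.update (fun _ => []) M.tm.k₁ z) s) (z.length + 1) v'
      (toStacks (fun _ => []) (Function.update s y ((z.map M.outputAlphabet).reverse ++ s y))) := by
  induction z generalizing s v with
  | nil =>
    refine ⟨(v.1, none, none), .exit ?_⟩
    simp only [callReversed, TM2.stepAux]
    erw [update_toStacks_inl]
    simp [toStacks]
  | cons b z ih =>
    obtain ⟨v', h⟩ := ih (Function.update s y (M.outputAlphabet b :: s y))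
      (v.1, some (M.outputAlphabet b), none)
    refine ⟨v', .step ?_ (by simpa using h)⟩
    simp only [callReversed, TM2.stepAux]
    erw [update_toStacks_inl]
    simp only [toStacks, Function.update_self]
    erw [update_toStacks_inr]
    simp

/-- Each step of `M` costs one step of the lifted code; `hs` is the continuation once `M` has
halted. -/
theorem reach_callReversed_run (x y : R) (s s' : R → List Bool) {n : ℕ} {c d : M.tm.Cfg}
    (h : (flip bind M.tm.step)^[n] (some c) = some d) (hd : d.l = none) {t : ℕ}
    {w : Option Bool × Option Bool}
    (hs : ∀ v, ∃ v', Reach (callReversed x y).code (some none) v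
      (toStacks d.stk s) t v' (toStacks (fun _ => []) s')) (l : M.tm.Λ) (hl : c.l = some l) :
    ∃ v', Reach (callReversed x y).code (some (some l)) (c.var, w) (toStacks c.stk s) (n + t) v'
      (toStacks (fun _ => []) s') := by
  induction n generalizing c l with
  | zero =>
    obtain rfl : c = d := by simpa using h
    simp [hd] at hl
  | succ n ih =>
    obtain ⟨cl, cv, cs⟩ := c
    obtain rfl : cl = some l := hl
    have key := stepAux_liftStmt (R := R) (M.tm.m l) cv w cs s
    rw [Function.iterate_succ_apply] at h
    change (flip bind M.tm.step)^[n] (some (TM2.stepAux (M.tm.m l) cv cs)) = _ at h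
    rcases hc : (TM2.stepAux (M.tm.m l) cv cs).l with _ | l'
    -- A halted configuration has no successor: any further iteration yields `none` and could not
    -- reach `d`.
    · have hn : n = 0 := by
        rcases n with _ | n
        · rfl
        · exfalso
          rw [Function.iterate_succ_apply] at h
          have : flip bind M.tm.step (some (TM2.stepAux (M.tm.m l) cv cs)) = none := by
            change TM2.step M.tm.m _ = none
            rcases he : TM2.stepAux (M.tm.m l) cv cs with ⟨l₁, v₁, s₁⟩
            rw [he] at hc
            simp only at hc
            subst hc
            rfl
          rw [this, Function.iterate_fixed rfl] at h
          simp at h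
      subst hn
      obtain rfl : TM2.stepAux (M.tm.m l) cv cs = d := Option.some.inj h
      obtain ⟨v', hv⟩ := hs ((TM2.stepAux (M.tm.m l) cv cs).var, w)
      refine ⟨v', ?_⟩
      rw [zero_add, add_comm]
      refine .step (key.trans ?_) hv
      rw [hc]
      rfl
    · obtain ⟨v', hv⟩ := ih h l' hc
      refine ⟨v', ?_⟩
      rw [add_right_comm]
      refine .step (key.trans ?_) hv
      rw [hc]
      rfl

/-- Induction on the content of `x`, with `i` the part already on the input stack. Popping reverses
the order, hence the input `(s x).reverse ++ i`. -/
theorem reach_callReversed_input (x y : R) (hxy : x ≠ y) (s : R → List Bool) (i j : List Bool)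
    {t : ℕ} (h : OutputsWithin M ((s x).reverse ++ i) j t) (v : Internal M) :
    ∃ v', ∃ t' ≤ (s x).length + 1 + t + (j.length + 1),
      Reach (callReversed x y).code none v
      (toStacks (Function.update (fun _ => []) M.tm.k₀ (i.map M.inputAlphabet.symm)) s) t' v'
      (toStacks (fun _ => [])
        (Function.update (Function.update s x []) y (j.reverse ++ s y))) := by
  induction hx : s x generalizing s i v with
  | nil =>
    obtain ⟨⟨⟨n, hn⟩, hnt⟩⟩ := h
    -- A halting configuration has all stacks empty except the output, so emptying the latter leaves
    -- `M` ready for another call.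
    have hout : (haltList M.tm (j.map M.outputAlphabet.symm)).stk =
        Function.update (fun _ => []) M.tm.k₁ (j.map M.outputAlphabet.symm) := by
      funext k
      by_cases hk : k = M.tm.k₁
      · subst hk; simp [haltList]
      · simp [haltList, hk]
    have hin : (initList M.tm (i.map M.inputAlphabet.symm)).stk =
        Function.update (fun _ => []) M.tm.k₀ (i.map M.inputAlphabet.symm) := by
      funext k
      by_cases hk : k = M.tm.k₀
      · subst hk; simp [initList]
      · simp [initList, hk]
    obtain ⟨v', hv⟩ := reach_callReversed_run x y s
      (Function.update s y (j.reverse ++ s y)) (w := (none, none))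
      (t := j.length + 1) hn rfl (fun v => by
        have := reach_callReversed_output x y s (j.map M.outputAlphabet.symm) v
        rw [hout]
        simpa using this) M.tm.main (by simp [hx, initList])
    have hs : Function.update s x [] = s := by rw [← hx, Function.update_eq_self]
    refine ⟨v', n + (j.length + 1) + 1, by simp at hnt ⊢; omega, .step ?_ (by rw [hs]; exact hv)⟩
    simp only [callReversed, TM2.stepAux]
    erw [update_toStacks_inr]
    simp only [toStacks, hx]
    simp [hs, hin]
    rfl
  | cons b z ih =>
    obtain ⟨v', t', ht', hv⟩ := ih (Function.update s x z) (b :: i) (by simpa [hx] using h)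
      (v.1, some b, none) (by simp)
    refine ⟨v', t' + 1, by simp; omega, .step ?_ (by simpa [hxy.symm] using hv)⟩
    simp only [callReversed, TM2.stepAux]
    erw [update_toStacks_inr]
    simp only [toStacks, hx]
    simp

theorem runs_callReversed {x y : R} (hxy : x ≠ y) {s : R → List Bool} {j : List Bool} {t : ℕ}
    (h : OutputsWithin M (s x).reverse j t) :
    Runs (callReversed x y : Prog M R) s (Function.update (Function.update s x []) y (j.reverse ++ s y))
      ((s x).length + 1 + t + (j.length + 1)) := by
  intro v
  have := reach_callReversed_input x y hxy s [] j (by simpa using h) v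
  rwa [List.map_nil, Function.update_eq_self] at this

end Call

/-! ### From programs to machines -/

section Machine

variable {M : TM2ComputableAux Bool Bool} {R : Type} [DecidableEq R] [Fintype R]

/-- The machine that runs a program, with the given input and output registers. -/
def machine (p : Prog M R) (i o : R) : TM2ComputableAux Bool Bool where
  tm :=
    letI := M.tm.kFin
    letI := M.tm.σFin
    letI := p.fin
    { K := Key M R
      k₀ := .inr i
      k₁ := .inr o
      Γ := Alphabet M R
      Λ := Option p.Λ
      main := some p.entry
      σ := Internal M
      initialState := (M.tm.initialState, none, none)
      Γk₀Fin := inferInstanceAs (Fintype Bool)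
      m := fun
        -- `haltList` prescribes the initial internal state, so it is restored before halting; this
        -- is the extra step in the time of the machine.
        | none => load (fun _ => (M.tm.initialState, none, none)) halt
        | some l => p.code l }
  inputAlphabet := Equiv.refl Bool
  outputAlphabet := Equiv.refl Bool

theorem Reach.iterate_machine {p : Prog M R} {i o : R} {l v S t v' S'}
    (h : Reach p.code l v S t v' S') :
    (flip bind (machine p i o).tm.step)^[t + 1] (some ⟨some (some l), v, S⟩) =
      some ⟨none, (M.tm.initialState, none, none), S'⟩ := by
  induction h with
  | @exit l v S v' S' h =>
    have h₁ : (machine p i o).tm.step ⟨some (some l), v, S⟩ = some ⟨some none, v', S'⟩ :=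
      congrArg some h
    exact (congrArg (flip bind (machine p i o).tm.step)^[1] h₁).trans rfl
  | @step l v S l₁ v₁ S₁ t v' S' h _ ih =>
    have h₁ : (machine p i o).tm.step ⟨some (some l), v, S⟩ = some ⟨some (some l₁), v₁, S₁⟩ :=
      congrArg some h
    exact (congrArg (flip bind (machine p i o).tm.step)^[t + 1] h₁).trans ih

-- `initList` and `haltList` define the stacks by a case distinction with the machine's own
-- decidability instance; this brings them to the form used by `Runs`.
omit [Fintype R] in
theorem cfg_dite_eq (k₀ : R) (x : List Bool) :
    (fun k : Key M R => @dite (List (Alphabet M R k)) (k = .inr k₀) (instDecidableEqKey _ _)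
      (fun h => by rw [h]; exact x) fun _ => []) =
    toStacks (fun _ => []) (Function.update (fun _ => []) k₀ x) := by
  funext k
  rcases k with k | k
  · simp [toStacks]
  · by_cases h : k = k₀
    · subst h; simp [toStacks]; rfl
    · simp [toStacks, h]

theorem Runs.outputsWithin {p : Prog M R} {i o : R} {x y : List Bool} {t : ℕ}
    (h : Runs p (Function.update (fun _ => []) i x) (Function.update (fun _ => []) o y) t) :
    OutputsWithin (machine p i o) x y (t + 1) := by
  obtain ⟨v', t', ht', h⟩ := h (M.tm.initialState, none, none)
  have key := h.iterate_machine (i := i) (o := o)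
  have h₁ : initList (machine p i o).tm (x.map (machine p i o).inputAlphabet.symm) =
      ⟨some (some p.entry), (M.tm.initialState, none, none),
        toStacks (fun _ => []) (Function.update (fun _ => []) i x)⟩ := by
    refine congrArg (TM2.Cfg.mk _ _) ((cfg_dite_eq i (x.map id)).trans ?_)
    rw [List.map_id]
  have h₂ : haltList (machine p i o).tm (y.map (machine p i o).outputAlphabet.symm) =
      ⟨none, (M.tm.initialState, none, none),
        toStacks (fun _ => []) (Function.update (fun _ => []) o y)⟩ := by
    refine congrArg (TM2.Cfg.mk _ _) ((cfg_dite_eq o (y.map id)).trans ?_)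
    rw [List.map_id]
  refine ⟨⟨⟨t' + 1, ?_⟩, by simpa using ht'⟩⟩
  rw [h₁, key, Option.map_some, h₂]

end Machine
/-! ### Binary numbers, least significant digit first -/

/-- The value of a list of binary digits. -/
def val : List Bool → ℕ
  | [] => 0
  | b :: x => b.toNat + 2 * val x

@[simp] theorem val_nil : val [] = 0 := rfl

@[simp] theorem val_cons (b : Bool) (x : List Bool) : val (b :: x) = b.toNat + 2 * val x := rfl

theorem val_append (x y : List Bool) : val (x ++ y) = val x + 2 ^ x.length * val y := by
  induction x with
  | nil => simp
  | cons b x ih => simp [ih, pow_succ]; ring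

theorem val_replicate_false (n : ℕ) : val (List.replicate n false) = 0 := by
  induction n with
  | zero => rfl
  | succ n ih => simp [List.replicate_succ, ih]

theorem val_drop (m : ℕ) (x : List Bool) : val (x.drop m) = val x / 2 ^ m := by
  induction m generalizing x with
  | zero => simp
  | succ m ih =>
    cases x with
    | nil => simp
    | cons b x =>
      rw [List.drop_succ_cons, ih, pow_succ', ← Nat.div_div_eq_div_mul, val_cons]
      congr 1
      cases b <;> simp; omega

/-- The first `m` digits, where missing digits are zero. -/
def digits : ℕ → List Bool → List Bool
  | 0, _ => []
  | m + 1, x => x.head?.getD false :: digits m x.tail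

@[simp] theorem length_digits (m : ℕ) (x : List Bool) : (digits m x).length = m := by
  induction m generalizing x with
  | zero => rfl
  | succ m ih => simp [digits, ih]

theorem val_digits (m : ℕ) (x : List Bool) : val (digits m x) = val x % 2 ^ m := by
  induction m generalizing x with
  | zero => simp [digits, Nat.mod_one]
  | succ m ih =>
    cases x with
    | nil => simp [digits, ih]
    | cons b x =>
      simp only [digits, List.head?_cons, Option.getD_some, List.tail_cons, val_cons, ih]
      rw [pow_succ', Nat.mod_mul]
      cases b
      · simp
      · simp only [Bool.toNat_true]
        have h₁ : (1 + 2 * val x) % 2 = 1 := by omega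
        have h₂ : (1 + 2 * val x) / 2 = val x := by omega
        rw [h₁, h₂]

/-- Allows a program to test a number for zero by marking its digits `true`. -/
theorem val_eq_zero_iff (x : List Bool) : val x = 0 ↔ x.count true = 0 := by
  induction x with
  | nil => simp
  | cons b x ih => cases b <;> simp_all

/-- Addition of binary numbers, with a carry. -/
def addBits : Bool → List Bool → List Bool → List Bool
  | c, [], [] => if c then [true] else []
  | c, a :: x, [] => (c ^^ a) :: addBits (c && a) x []
  | c, [], b :: y => (c ^^ b) :: addBits (c && b) [] y
  | c, a :: x, b :: y => (c ^^ a ^^ b) :: addBits (a && b || c && (a || b)) x y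

theorem val_addBits (c : Bool) (x y : List Bool) :
    val (addBits c x y) = c.toNat + val x + val y := by
  induction c, x, y using addBits.induct with
  | case1 => simp [addBits]
  | case2 c hc => simp at hc; simp [addBits, hc]
  | case3 c a x ih => simp only [addBits, val_cons, ih]; cases c <;> cases a <;> (simp; try ring)
  | case4 c b y ih => simp only [addBits, val_cons, ih]; cases c <;> cases b <;> (simp; try ring)
  | case5 c a x b y ih =>
    simp only [addBits, val_cons, ih]
    cases c <;> cases a <;> cases b <;> simp <;> ring

theorem length_addBits_le (c : Bool) (x y : List Bool) :
    (addBits c x y).length ≤ max x.length y.length + 1 := by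
  induction c, x, y using addBits.induct with
  | case1 => simp [addBits]
  | case2 c hc => simp at hc; simp [addBits, hc]
  | case3 c a x ih => simp [addBits] at ih ⊢; omega
  | case4 c b y ih => simp [addBits] at ih ⊢; omega
  | case5 c a x b y ih => simp [addBits] at ih ⊢; omega

/-- Prepend a digit, but no zero to the empty list. -/
def consBit : Bool → List Bool → List Bool
  | false, [] => []
  | b, x => b :: x

/-- Remove the leading zeros of a binary number. -/
def trim (x : List Bool) : List Bool := x.foldr consBit []

theorem length_trim_le (x : List Bool) : (trim x).length ≤ x.length := by
  induction x with
  | nil => simp [trim]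
  | cons b x ih =>
    change (consBit b (trim x)).length ≤ _
    cases b <;> cases h : trim x <;> simp_all [consBit]

theorem encodeNat_eq_bits (n : ℕ) : encodeNat n = n.bits := by
  have key : ∀ p : PosNum, encodePosNum p = (p : ℕ).bits := by
    intro p
    induction p with
    | one => simp [encodePosNum]
    | bit0 p ih =>
      have hp : (p : ℕ) ≠ 0 := (PosNum.cast_pos p).ne'
      rw [encodePosNum, ih, PosNum.cast_bit0, ← two_mul, Nat.bit0_bits _ hp]
    | bit1 p ih => rw [encodePosNum, ih, PosNum.cast_bit1, ← two_mul]; simp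
  unfold encodeNat
  conv_rhs => rw [← Num.to_of_nat n]
  cases (n : Num) with
  | zero => simp [encodeNum]
  | pos p => simpa [encodeNum] using key p

theorem val_encodeNat (n : ℕ) : val (encodeNat n) = n := by
  rw [encodeNat_eq_bits]
  induction n using Nat.binaryRec' with
  | zero => simp
  | bit b n h ih => rw [Nat.bits_append_bit _ _ h, val_cons, ih, Nat.bit_val]; ring

/-- Arithmetic on registers may leave leading zeros; trimming them restores the canonical code
required of the output. -/
theorem encodeNat_val (x : List Bool) : encodeNat (val x) = trim x := by
  rw [encodeNat_eq_bits]
  induction x with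
  | nil => simp [trim]
  | cons b x ih =>
    change _ = consBit b (trim x)
    rw [← ih, val_cons]
    cases b
    · rcases Nat.eq_zero_or_pos (val x) with h | h
      · simp [h, consBit]
      · have h' : (val x).bits ≠ [] := by
          intro h0
          have := val_encodeNat (val x)
          rw [encodeNat_eq_bits, h0] at this
          simp at this
          omega
        have := Nat.bit0_bits (val x) h.ne'
        simp only [Bool.toNat_false, zero_add, this]
        cases h₁ : (val x).bits <;> simp_all [consBit]
    · simp only [Bool.toNat_true, add_comm 1, Nat.bit1_bits]
      cases h₁ : (val x).bits <;> simp [consBit]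

theorem length_encodeNat (n : ℕ) : (encodeNat n).length = n.size := by
  rw [encodeNat_eq_bits]; simp [Nat.size_eq_bits_len]

/-! ### Elementary programs: moving, adding, calling, trimming, conversion to unary -/

section Programs

variable {M : TM2ComputableAux Bool Bool} {R : Type} [DecidableEq R]

/-- Move a register to another one, in reverse order. -/
def move (a b : R) : Prog M R := loop a (push b false) (push b true)

theorem runs_move {a b : R} (h : a ≠ b) (s : R → List Bool) :
    Runs (move a b : Prog M R) s
      (Function.update (Function.update s a []) b ((s a).reverse ++ s b))
      (2 * (s a).length + 1) := by
  induction hx : s a generalizing s with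
  | nil =>
    refine (runs_loop_nil hx).mono ?_ (by simp)
    funext r
    simp only [Function.update_apply]
    split_ifs <;> simp_all
  | cons c x ih =>
    refine (runs_loop_cons c hx (s' := Function.update (Function.update s a x) b (c :: s b))
      (t := 1) ?_ (ih (Function.update (Function.update s a x) b (c :: s b)) (by simp [h]))).mono
      ?_ (by simp; omega)
    · have := runs_push (M := M) b c (Function.update s a x)
      rw [Function.update_of_ne h.symm] at this
      cases c <;> exact this
    · funext r
      simp only [Function.update_apply]
      split_ifs <;> simp_all

/-- Make a register empty. -/
def clear (a : R) : Prog M R := loop a skip skip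

theorem runs_clear (a : R) (s : R → List Bool) :
    Runs (clear a : Prog M R) s (Function.update s a []) (2 * (s a).length + 1) := by
  induction hx : s a generalizing s with
  | nil =>
    refine (runs_loop_nil hx).mono ?_ (by simp)
    rw [← hx, Function.update_eq_self]
  | cons c x ih =>
    refine (runs_loop_cons c hx (s' := Function.update s a x)
      (t := 1) ?_ (ih (Function.update s a x) (by simp))).mono (by simp) (by simp; omega)
    cases c <;> exact runs_skip _

/-- For every symbol of a register `c`, which is used up, push the bit `b` on the register `r`. -/
def pushTimes (c r : R) (b : Bool) : Prog M R := loop c (push r b) (push r b)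

theorem runs_pushTimes {c r : R} (h : c ≠ r) (b : Bool) (s : R → List Bool) :
    Runs (pushTimes c r b : Prog M R) s
      (Function.update (Function.update s c []) r (List.replicate (s c).length b ++ s r))
      (2 * (s c).length + 1) := by
  induction hx : s c generalizing s with
  | nil =>
    refine (runs_loop_nil hx).mono ?_ (by simp)
    funext r
    simp only [Function.update_apply]
    split_ifs <;> simp_all
  | cons a x ih =>
    refine (runs_loop_cons a hx (s' := Function.update (Function.update s c x) r (b :: s r))
      (t := 1) ?_ (ih (Function.update (Function.update s c x) r (b :: s r)) (by simp [h]))).mono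
      ?_ (by simp; omega)
    · have := runs_push (M := M) r b (Function.update s c x)
      rw [Function.update_of_ne h.symm] at this
      cases a <;> exact this
    · funext k
      simp only [Function.update_apply]
      split_ifs <;> simp_all [List.replicate_succ']

/-- Move a register `t` to both `a` and `b`, in reverse order. -/
def moveBoth (t a b : R) : Prog M R :=
  loop t (push a false ;; push b false) (push a true ;; push b true)

theorem runs_moveBoth {t a b : R} (hta : t ≠ a) (htb : t ≠ b) (hab : a ≠ b) (s : R → List Bool) :
    Runs (moveBoth t a b : Prog M R) s
      (Function.update (Function.update (Function.update s t []) a ((s t).reverse ++ s a)) b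
        ((s t).reverse ++ s b)) (3 * (s t).length + 1) := by
  induction hx : s t generalizing s with
  | nil =>
    refine (runs_loop_nil hx).mono ?_ (by simp)
    funext r
    simp only [Function.update_apply]
    split_ifs <;> simp_all
  | cons c x ih =>
    refine (runs_loop_cons c hx
      (s' := Function.update (Function.update (Function.update s t x) a (c :: s a)) b (c :: s b))
      (t := 2) ?_ (ih (Function.update (Function.update (Function.update s t x) a (c :: s a)) b
        (c :: s b)) (by simp [hta, htb]))).mono ?_ (by simp; omega)
    · have := (runs_push (M := M) a c (Function.update s t x)).seq (runs_push b c _)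
      rw [Function.update_of_ne hta.symm, Function.update_of_ne hab.symm,
        Function.update_of_ne htb.symm] at this
      cases c <;> exact this
    · funext r
      simp only [Function.update_apply]
      split_ifs <;> simp_all

/-- Put a copy of `a` on top of `b`, with the help of an empty register `t`. -/
def copy (a b t : R) : Prog M R := move a t ;; moveBoth t a b

theorem runs_copy {a b t : R} (hab : a ≠ b) (hat : a ≠ t) (hbt : b ≠ t) {s : R → List Bool}
    (ht : s t = []) :
    Runs (copy a b t : Prog M R) s (Function.update s b (s a ++ s b)) (5 * (s a).length + 2) := by
  refine ((runs_move hat s).seq (runs_moveBoth hat.symm hbt.symm hab _)).mono ?_ ?_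
  · funext r
    simp only [Function.update_apply]
    split_ifs <;> simp_all
  · simp [ht]; omega

section Add

open TM2.Stmt

/-- Add the binary numbers in `x` and `y`, and push the digits of the sum on `t`. -/
def addReversed (x y t : R) : Prog M R where
  Λ := Bool
  fin := inferInstance
  entry := false
  code c := pop (.inr x) (fun v o => (v.1, o, none)) <| pop (.inr y) (fun v o => (v.1, v.2.1, o)) <|
    branch (fun v => v.2.1.isNone && v.2.2.isNone)
      (if c then TM2.Stmt.push (.inr t) (fun _ => true) (goto fun _ => none)
        else goto fun _ => none)
      (TM2.Stmt.push (.inr t) (fun v => c ^^ v.2.1.getD false ^^ v.2.2.getD false)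
        (goto fun v => some (v.2.1.getD false && v.2.2.getD false ||
          c && (v.2.1.getD false || v.2.2.getD false))))

theorem stepAux_pop_pop {Λ : Type} {x y : R} (hxy : x ≠ y)
    (q : TM2.Stmt (Alphabet M R) Λ (Internal M)) (v : Internal M) (s : R → List Bool) :
    TM2.stepAux (Γ := Alphabet M R)
      (pop (.inr x) (fun v (o : Option Bool) => (v.1, o, none)) <|
        pop (.inr y) (fun v (o : Option Bool) => (v.1, v.2.1, o)) q) v (toStacks (fun _ => []) s) =
    TM2.stepAux q (v.1, (s x).head?, (s y).head?)
      (toStacks (fun _ => []) (Function.update (Function.update s x (s x).tail) y (s y).tail)) := by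
  have h : Function.update s x (s x).tail y = s y := Function.update_of_ne hxy.symm ..
  simp only [TM2.stepAux]
  erw [update_toStacks_inr, update_toStacks_inr]
  simp only [toStacks]
  rw [← h]
  rfl

theorem addBits_of_ne (c : Bool) (x y : List Bool) (h : (x.head?.isNone && y.head?.isNone) = false) :
    addBits c x y = (c ^^ x.head?.getD false ^^ y.head?.getD false) ::
      addBits (x.head?.getD false && y.head?.getD false ||
          c && (x.head?.getD false || y.head?.getD false)) x.tail y.tail := by
  cases x <;> cases y <;> simp_all [addBits]

theorem runs_addReversed {x y t : R} (hxy : x ≠ y) (hxt : x ≠ t) (hyt : y ≠ t)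
    (s : R → List Bool) :
    Runs (addReversed x y t : Prog M R) s
      (Function.update (Function.update (Function.update s x []) y []) t
        ((addBits false (s x) (s y)).reverse ++ s t)) (max (s x).length (s y).length + 1) := by
  -- The label of the code is the carry, so the induction on the remaining digits must allow any
  -- initial carry.
  suffices H : ∀ (n : ℕ) (c : Bool) (s : R → List Bool), max (s x).length (s y).length = n → ∀ v,
      ∃ v', Reach (addReversed x y t : Prog M R).code c v (toStacks (fun _ => []) s) (n + 1) v'
        (toStacks (fun _ => []) (Function.update (Function.update (Function.update s x []) y []) t
        ((addBits c (s x) (s y)).reverse ++ s t))) from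
    fun v => (H _ false s rfl v).imp fun v' h => ⟨_, le_rfl, h⟩
  intro n
  induction n with
  | zero =>
    intro c s hs v
    have hx : s x = [] := List.length_eq_zero_iff.1 (by omega)
    have hy : s y = [] := List.length_eq_zero_iff.1 (by omega)
    have hs : Function.update (Function.update s x []) y [] = s := by
      rw [← hx, Function.update_eq_self, hx, ← hy, Function.update_eq_self]
    refine ⟨(v.1, none, none), .exit ((stepAux_pop_pop hxy _ _ _).trans ?_)⟩
    cases c
    · simp [hx, hy, addBits, hs]
      rfl
    · simp only [hx, hy, List.head?_nil, List.tail_nil, hs, TM2.stepAux, Option.isNone_none,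
        Bool.and_self, cond_true, if_true]
      erw [update_toStacks_inr]
      simp [addBits]
      rfl
  | succ n ih =>
    intro c s hs v
    obtain ⟨v', h⟩ := ih ((s x).head?.getD false && (s y).head?.getD false ||
          c && ((s x).head?.getD false || (s y).head?.getD false))
      (Function.update (Function.update (Function.update s x (s x).tail) y (s y).tail) t
        ((c ^^ (s x).head?.getD false ^^ (s y).head?.getD false) :: s t))
      (by simp [hxy, hxt, hyt]; omega) (v.1, (s x).head?, (s y).head?)
    have hne : ((s x).head?.isNone && (s y).head?.isNone) = false := by
      cases h₁ : s x <;> cases h₂ : s y <;> simp_all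
    have hfin : Function.update (Function.update (Function.update (Function.update
        (Function.update (Function.update s x (s x).tail) y (s y).tail) t
        ((c ^^ (s x).head?.getD false ^^ (s y).head?.getD false) :: s t)) x []) y []) t
        ((addBits ((s x).head?.getD false && (s y).head?.getD false ||
          c && ((s x).head?.getD false || (s y).head?.getD false)) (s x).tail (s y).tail).reverse ++
            (c ^^ (s x).head?.getD false ^^ (s y).head?.getD false) :: s t) =
        Function.update (Function.update (Function.update s x []) y []) t
          ((addBits c (s x) (s y)).reverse ++ s t) := by
      funext k
      rw [addBits_of_ne _ _ _ hne]
      simp only [Function.update_apply]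
      split_ifs <;> simp_all
    simp only [Function.update_of_ne hxy, Function.update_of_ne hxt, Function.update_of_ne hyt,
      Function.update_self, hfin] at h
    refine ⟨v', .step ((stepAux_pop_pop hxy _ _ _).trans ?_) h⟩
    simp only [TM2.stepAux, hne, cond_false]
    erw [update_toStacks_inr]
    simp [hxt.symm, hyt.symm]
    rfl

end Add

/-- Add the binary number in `y`, which is used up, to `x`. -/
def addTo (x y t : R) : Prog M R := addReversed x y t ;; move t x

theorem runs_addTo {x y t : R} (hxy : x ≠ y) (hxt : x ≠ t) (hyt : y ≠ t) {s : R → List Bool}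
    (ht : s t = []) :
    Runs (addTo x y t : Prog M R) s
      (Function.update (Function.update s x (addBits false (s x) (s y))) y [])
      (3 * max (s x).length (s y).length + 4) := by
  refine ((runs_addReversed hxy hxt hyt s).seq (runs_move hxt.symm _)).mono ?_ ?_
  · funext r
    simp only [Function.update_apply]
    split_ifs <;> simp_all
  · have := length_addBits_le false (s x) (s y)
    simp [ht]; omega

/-- Call the machine `M` with the input `x`, which is used up, and put the output on `y`. -/
def call (x y t : R) : Prog M R := move x t ;; callReversed t x ;; move x y

theorem runs_call {x y t : R} (hxy : x ≠ y) (hxt : x ≠ t) (hyt : y ≠ t) {s : R → List Bool}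
    (ht : s t = []) {j : List Bool} {u : ℕ} (h : OutputsWithin M (s x) j u) :
    Runs (call x y t : Prog M R) s
      (Function.update (Function.update s x []) y (j ++ s y))
      (3 * (s x).length + u + 3 * j.length + 4) := by
  refine ((runs_move hxt s).seq ((runs_callReversed (M := M) hxt.symm (j := j) (t := u) ?_).seq
    (runs_move hxy _))).mono ?_ ?_
  · simpa [ht] using h
  · funext r
    simp only [Function.update_apply]
    split_ifs <;> simp_all
  · simp [hxt, ht]; omega

/-- Push the digits of a register `t` on the register `x`, omitting zeros as long as `x` is
empty. -/
def trimMove (t x : R) : Prog M R :=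
  -- Emptiness of `x` can only be tested by popping, so a popped symbol is pushed back before the
  -- new zero.
  loop t (popCases x skip (push x false ;; push x false) (push x true ;; push x false)) (push x true)

theorem runs_trimMove {t x : R} (h : t ≠ x) (s : R → List Bool) :
    Runs (trimMove t x : Prog M R) s
      (Function.update (Function.update s t []) x ((s t).foldl (fun y b => consBit b y) (s x)))
      (4 * (s t).length + 1) := by
  induction hx : s t generalizing s with
  | nil =>
    refine (runs_loop_nil hx).mono ?_ (by simp)
    funext r
    simp only [Function.update_apply]
    split_ifs <;> simp_all
  | cons c y ih =>
    refine (runs_loop_cons c hx (s' := Function.update (Function.update s t y) x (consBit c (s x)))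
      (t := 3) ?_ (ih (Function.update (Function.update s t y) x (consBit c (s x)))
        (by simp [h]))).mono ?_ (by simp; omega)
    · cases c
      · simp only [Bool.false_eq_true, if_false]
        cases hsx : s x with
        | nil =>
          refine (runs_popCases_nil (by simp [h.symm, hsx]) (runs_skip _)).mono ?_ (by omega)
          funext r
          simp only [Function.update_apply]
          split_ifs <;> simp_all [consBit]
        | cons b z =>
          refine (runs_popCases_cons b (x := z) (by simp [h.symm, hsx])
            (t := 2) (s' := Function.update (Function.update s t y) x (false :: b :: z)) ?_).mono
            ?_ (by omega)
          · cases b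
            · exact ((runs_push _ _ _).seq (runs_push _ _ _)).mono (by simp) le_rfl
            · exact ((runs_push _ _ _).seq (runs_push _ _ _)).mono (by simp) le_rfl
          · simp [consBit]
      · refine (runs_push _ _ _).mono ?_ (by omega)
        simp [consBit, h.symm]
    · funext r
      simp only [Function.update_apply]
      split_ifs <;> simp_all

/-- Remove the leading zeros of a register. -/
def trimReg (x t : R) : Prog M R := move x t ;; trimMove t x

theorem runs_trimReg {x t : R} (h : x ≠ t) {s : R → List Bool} (ht : s t = []) :
    Runs (trimReg x t : Prog M R) s (Function.update s x (trim (s x))) (6 * (s x).length + 2) := by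
  refine ((runs_move h s).seq (runs_trimMove h.symm _)).mono ?_ ?_
  · funext r
    simp only [Function.update_apply]
    split_ifs <;> simp_all [trim]
  · simp [ht]; omega

/-- Double the length of a register. -/
def double (x t : R) : Prog M R :=
  loop x (push t true ;; push t true) (push t true ;; push t true) ;; move t x

theorem runs_double {x t : R} (h : x ≠ t) {s : R → List Bool} (ht : s t = []) :
    Runs (double x t : Prog M R) s
      (Function.update s x (List.replicate (2 * (s x).length) true)) (7 * (s x).length + 2) := by
  have key : ∀ s : R → List Bool, Runs
      (loop x (push t true ;; push t true) (push t true ;; push t true) : Prog M R) s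
      (Function.update (Function.update s x []) t
        (List.replicate (2 * (s x).length) true ++ s t)) (3 * (s x).length + 1) := by
    intro s
    induction hx : s x generalizing s with
    | nil =>
      refine (runs_loop_nil hx).mono ?_ (by simp)
      funext r
      simp only [Function.update_apply]
      split_ifs <;> simp_all
    | cons a y ih =>
      refine (runs_loop_cons a hx
        (s' := Function.update (Function.update s x y) t (true :: true :: s t))
        (t := 2) ?_ (ih (Function.update (Function.update s x y) t (true :: true :: s t))
          (by simp [h]))).mono ?_ (by simp; omega)
      · have := (runs_push (M := M) t true (Function.update s x y)).seq (runs_push t true _)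
        simp only [Function.update_of_ne h.symm, Function.update_self, Function.update_idem] at this
        cases a <;> exact this
      · funext k
        simp only [Function.update_apply]
        split_ifs <;> simp_all [mul_add, List.replicate_succ']
  refine ((key s).seq (runs_move h.symm _)).mono ?_ ?_
  · funext r
    simp only [Function.update_apply]
    split_ifs <;> simp_all
  · simp [ht]; omega

/-- Convert a binary number, which is used up, to a unary one. -/
def toUnary (x u t : R) : Prog M R :=
  move x t ;; loop t (double u x) (double u x ;; push u true)

theorem runs_toUnary {x u t : R} (hxu : x ≠ u) (hxt : x ≠ t) (hut : u ≠ t) {s : R → List Bool}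
    (hu : s u = []) (ht : s t = []) :
    Runs (toUnary x u t : Prog M R) s
      (Function.update (Function.update s x []) u (List.replicate (val (s x)) true))
      ((s x).length * (7 * val (s x) + 6) + 2) := by
  -- Horner's scheme: `t` holds the remaining digits, most significant first, and `u` the value `m`
  -- read so far. `B` bounds the final value, hence every intermediate `m`, and so the cost of each
  -- doubling.
  have key : ∀ (y : List Bool) (s : R → List Bool) (m B : ℕ), s x = [] → s t = y →
      s u = List.replicate m true → val (y.reverse ++ encodeNat m) ≤ B → Runs
      (loop t (double u x) (double u x ;; push u true) : Prog M R) s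
      (Function.update (Function.update s t []) u
        (List.replicate (val (y.reverse ++ encodeNat m)) true)) (y.length * (7 * B + 4) + 1) := by
    intro y
    induction y with
    | nil =>
      intro s m B hx hy hu _
      refine (runs_loop_nil hy).mono ?_ (by simp)
      funext r
      simp only [Function.update_apply]
      split_ifs <;> simp_all [val_encodeNat]
    | cons b y ih =>
      intro s m B hx hy hu hB
      have hval : val ((b :: y).reverse ++ encodeNat m) =
          val (y.reverse ++ encodeNat (2 * m + b.toNat)) := by
        simp only [List.reverse_cons, List.append_assoc, List.cons_append, List.nil_append]
        rw [val_append, val_append, val_cons, val_encodeNat, val_encodeNat]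
        ring
      have hmB : m ≤ B := by
        refine le_trans ?_ hB
        rw [val_append, val_encodeNat]
        nlinarith [Nat.one_le_two_pow (n := (b :: y).reverse.length)]
      rw [hval] at hB ⊢
      have step : Runs (if b then (double u x ;; push u true) else double u x : Prog M R)
          (Function.update s t y)
          (Function.update (Function.update s t y) u (List.replicate (2 * m + b.toNat) true))
          (7 * B + 3) := by
        have hd := runs_double (M := M) hxu.symm (s := Function.update s t y) (by simp [hxt, hx])
        cases b
        · refine hd.mono ?_ ?_
          · simp [hut, hu]
          · simp [hut, hu]; omega
        · refine (hd.seq (runs_push u true _)).mono ?_ ?_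
          · simp [hut, hu, List.replicate_succ]
          · simp [hut, hu]; omega
      refine (runs_loop_cons b hy step (ih _ (2 * m + b.toNat) B ?_ ?_ ?_ hB)).mono ?_ ?_
      · simp [hxu, hxt, hx]
      · simp [hut.symm]
      · simp
      · funext r
        simp only [Function.update_apply]
        split_ifs <;> simp_all
      · simp only [List.length_cons, add_mul]; omega
  have h0 : encodeNat 0 = [] := by simp [encodeNat_eq_bits]
  refine ((runs_move hxt s).seq (key (s x).reverse _ 0 (val (s x)) ?_ ?_ ?_ ?_)).mono ?_ ?_
  · simp [hxt]
  · simp [ht]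
  · simp [hut, hxu.symm, hu]
  · simp [h0]
  · funext r
    simp only [Function.update_apply]
    split_ifs <;> simp_all
  · rw [List.length_reverse]; ring_nf; omega

end Programs

end StackProgram

/-! ### Partitions into distinct parts: counting, Kronecker substitution, lower bound -/

section Counting

open Finset

/-- The sets of positive integers with sum `n`. -/
def setsWithSum (n : ℕ) : Finset (Finset ℕ) := (Icc 1 n).powerset.filter fun s => ∑ i ∈ s, i = n

theorem mem_setsWithSum {n : ℕ} {s : Finset ℕ} :
    s ∈ setsWithSum n ↔ (∀ i ∈ s, 1 ≤ i) ∧ ∑ i ∈ s, i = n := by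
  simp only [setsWithSum, mem_filter, mem_powerset, subset_iff, mem_Icc]
  refine ⟨fun h => ⟨fun i hi => (h.1 hi).1, h.2⟩, fun h => ⟨fun i hi => ⟨h.1 i hi, ?_⟩, h.2⟩⟩
  rw [← h.2]
  exact single_le_sum (f := fun i => i) (fun _ _ => Nat.zero_le _) hi

/-- A partition into distinct parts is the same as its set of parts. -/
theorem distinctPartsSum_eq_sum (g : ℕ → ℕ) (n : ℕ) :
    distinctPartsSum g n = ∑ s ∈ setsWithSum n, g s.card := by
  refine sum_bij (fun p _ => p.parts.toFinset) ?_ ?_ ?_ ?_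
  · intro p hp
    simp only [Nat.Partition.distincts, mem_filter] at hp
    rw [mem_setsWithSum]
    refine ⟨fun i hi => p.parts_pos (Multiset.mem_toFinset.1 hi), ?_⟩
    simp [Finset.sum, Multiset.toFinset_val, hp.2.dedup, p.parts_sum]
  · intro p hp q hq h
    simp only [Nat.Partition.distincts, mem_filter] at hp hq
    ext1
    rw [← hp.2.dedup, ← hq.2.dedup, ← Multiset.toFinset_val, h, Multiset.toFinset_val]
  · intro s hs
    rw [mem_setsWithSum] at hs
    refine ⟨⟨s.val, fun hi => hs.1 _ hi, by simpa using hs.2⟩, ?_, ?_⟩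
    · simp [Nat.Partition.distincts, s.nodup]
    · simp
  · intro p hp
    simp only [Nat.Partition.distincts, mem_filter] at hp
    rw [Multiset.toFinset_card_of_nodup hp.2]

theorem numDistinctPartitions_eq_card (k n : ℕ) :
    numDistinctPartitions k n = #{s ∈ setsWithSum n | #s = k} := by
  have := distinctPartsSum_eq_sum (fun j => if j = k then 1 else 0) n
  rw [numDistinctPartitions, card_filter, card_filter]
  exact this

theorem distinctPartsSum_eq_sum_Icc (g : ℕ → ℕ) {n : ℕ} (hn : 1 ≤ n) :
    distinctPartsSum g n = ∑ k ∈ Icc 1 n, g k * numDistinctPartitions k n := by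
  unfold distinctPartsSum
  rw [← sum_fiberwise_of_maps_to (t := Icc 1 n) (g := fun p => p.parts.card)]
  · refine sum_congr rfl fun k _ => ?_
    rw [sum_congr rfl (g := fun _ => g k) fun p hp => by rw [(mem_filter.1 hp).2], sum_const,
      smul_eq_mul, mul_comm, numDistinctPartitions]
  · intro p _
    rw [mem_Icc]
    constructor
    · rw [Nat.one_le_iff_ne_zero, Ne, Multiset.card_eq_zero]
      intro h
      have := p.parts_sum
      simp [h] at this
      omega
    · conv_rhs => rw [← p.parts_sum]
      simpa using Multiset.card_nsmul_le_sum (s := p.parts) (a := 1) fun i hi => p.parts_pos hi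

/-- These compositions are the orderings of a list without repetitions, that is, its permutations.
-/
theorem card_compositions_of_partition {n : ℕ} (p : n.Partition) (hp : p.parts.Nodup) :
    #{c : Composition n | (c.blocks : Multiset ℕ) = p.parts} = p.parts.card.factorial := by
  obtain ⟨l, hl⟩ := Quot.exists_rep p.parts
  replace hl : (l : Multiset ℕ) = p.parts := hl
  rw [← hl] at hp ⊢
  rw [Multiset.coe_nodup] at hp
  rw [Multiset.coe_card, ← List.length_permutations,
    ← List.toFinset_card_of_nodup (List.nodup_permutations l hp)]
  refine card_bij (fun c _ => c.blocks) ?_ ?_ ?_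
  · intro c hc
    simpa using hc
  · intro c _ d _ h
    exact Composition.ext h
  · intro l' hl'
    rw [List.mem_toFinset, List.mem_permutations] at hl'
    have h' : (l' : Multiset ℕ) = p.parts := by rw [← hl]; exact Multiset.coe_eq_coe.2 hl'
    refine ⟨⟨l', fun {i} hi => p.parts_pos ?_, ?_⟩, ?_, rfl⟩
    · rw [← h']; exact hi
    · rw [← Multiset.sum_coe, h', p.parts_sum]
    · simpa using hl'

theorem numDistinctCompositions_eq_distinctPartsSum (n : ℕ) :
    numDistinctCompositions n = distinctPartsSum Nat.factorial n := by
  unfold numDistinctCompositions distinctPartsSum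
  rw [card_eq_sum_card_fiberwise (f := Nat.Partition.ofComposition n)
    (t := Nat.Partition.distincts n)]
  · refine sum_congr rfl fun p hp => ?_
    simp only [Nat.Partition.distincts, mem_filter] at hp
    rw [← card_compositions_of_partition p hp.2, filter_filter]
    congr 1
    ext c
    simp only [mem_filter, mem_univ, true_and, Nat.Partition.ext_iff]
    change _ ∧ (c.blocks : Multiset ℕ) = _ ↔ _
    refine ⟨fun h => h.2, fun h => ⟨?_, h⟩⟩
    rw [← Multiset.coe_nodup, h]
    exact hp.2
  · intro c hc
    simpa [Nat.Partition.distincts] using hc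

/-- A number with `m` digits in base `X` cannot carry into position `m`. -/
theorem sum_mul_pow_lt {X : ℕ} (c : ℕ → ℕ) (hc : ∀ d, c d < X) (m : ℕ) :
    ∑ d ∈ range m, c d * X ^ d < X ^ m := by
  induction m with
  | zero => simp
  | succ m ih =>
    rw [sum_range_succ, pow_succ']
    have := Nat.mul_le_mul_right (X ^ m) (Nat.succ_le_of_lt (hc m))
    rw [Nat.succ_mul] at this
    omega

/-- The digits of a sum of powers of the base. -/
theorem sum_pow_div_mod {ι : Type*} (J : Finset ι) (e : ι → ℕ) {X : ℕ}
    (h : ∀ m, #{j ∈ J | e j = m} < X) (m : ℕ) :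
    (∑ j ∈ J, X ^ e j) / X ^ m % X = #{j ∈ J | e j = m} := by
  have hX : 0 < X := (Nat.zero_le _).trans_lt (h 0)
  -- The terms with smaller exponent add up to less than `X ^ m`, since their multiplicities are
  -- digits. Those with larger exponent are divisible by `X ^ (m + 1)`, so only the exponent `m`
  -- survives.
  have h₁ : ∑ j ∈ J with e j < m, X ^ e j < X ^ m := by
    rw [← sum_fiberwise_of_maps_to (t := range m) (g := e) (by simp)]
    refine lt_of_eq_of_lt (sum_congr rfl fun d hd => ?_)
      (sum_mul_pow_lt (fun m => #{j ∈ J | e j = m}) h m)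
    rw [filter_filter, sum_congr rfl (g := fun _ => X ^ d) fun j hj => by
      rw [(mem_filter.1 hj).2.2], sum_const, smul_eq_mul]
    congr 2
    ext j
    simp only [mem_filter, mem_range] at hd ⊢
    constructor
    · rintro ⟨a, b, c⟩; exact ⟨a, c⟩
    · rintro ⟨a, rfl⟩; exact ⟨a, hd, rfl⟩
  have h₂ : ∑ j ∈ J with e j = m, X ^ e j = #{j ∈ J | e j = m} * X ^ m := by
    rw [sum_congr rfl (g := fun _ => X ^ m) fun j hj => by rw [(mem_filter.1 hj).2], sum_const,
      smul_eq_mul]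
  obtain ⟨a, h₃⟩ : X ^ (m + 1) ∣ ∑ j ∈ J with m < e j, X ^ e j :=
    dvd_sum fun j hj => pow_dvd_pow _ (mem_filter.1 hj).2
  have h₄ : ∑ j ∈ J, X ^ e j = ∑ j ∈ J with e j < m, X ^ e j + ∑ j ∈ J with e j = m, X ^ e j +
      ∑ j ∈ J with m < e j, X ^ e j := by
    rw [← sum_filter_add_sum_filter_not J (fun j => e j < m), add_assoc]
    congr 1
    rw [← sum_filter_add_sum_filter_not _ (fun j => e j = m), filter_filter, filter_filter]
    congr 2 <;> ext j <;> simp only [mem_filter] <;> constructor <;> intro h <;>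
      refine ⟨h.1, ?_⟩ <;> omega
  rw [h₄, h₂, h₃, add_assoc, show #{j ∈ J | e j = m} * X ^ m + X ^ (m + 1) * a =
    (#{j ∈ J | e j = m} + X * a) * X ^ m by ring, Nat.add_mul_div_right _ _ (by positivity),
    Nat.div_eq_of_lt h₁, zero_add, Nat.add_mul_mod_self_left, Nat.mod_eq_of_lt (h m)]

/-- The product whose binary digits contain the numbers of partitions into distinct parts. -/
theorem prod_div_mod {n k : ℕ} (hk : k ≤ n) :
    (∏ i ∈ Icc 1 n, (1 + 2 ^ ((n + 1) + (n + 1) ^ 2 * i))) / 2 ^ ((n + 1) * (k + (n + 1) * n)) %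
      2 ^ (n + 1) = numDistinctPartitions k n := by
  have h₁ : ∏ i ∈ Icc 1 n, (1 + 2 ^ ((n + 1) + (n + 1) ^ 2 * i)) =
      ∑ s ∈ (Icc 1 n).powerset, (2 ^ (n + 1)) ^ (#s + (n + 1) * ∑ i ∈ s, i) := by
    rw [prod_one_add]
    refine sum_congr rfl fun s _ => ?_
    rw [prod_pow_eq_pow_sum, ← pow_mul]
    congr 1
    rw [sum_add_distrib, sum_const, ← mul_sum, smul_eq_mul]
    ring
  rw [h₁, pow_mul, sum_pow_div_mod, numDistinctPartitions_eq_card]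
  · congr 1
    ext s
    simp only [setsWithSum, mem_filter, mem_powerset, and_assoc]
    refine and_congr_right fun hs => ⟨fun h => ?_, fun ⟨h, h'⟩ => by rw [h, h']⟩
    have hc : #s ≤ n := by simpa using card_le_card hs
    -- As `#s` and `k` are at most `n`, division by `n + 1` recovers the sum of `s`; the cardinality
    -- is then the remainder.
    have e₁ : (#s + (n + 1) * ∑ i ∈ s, i) / (n + 1) = (k + (n + 1) * n) / (n + 1) := by rw [h]
    rw [Nat.add_mul_div_left _ _ (by omega), Nat.add_mul_div_left _ _ (by omega),
      Nat.div_eq_of_lt (by omega), Nat.div_eq_of_lt (by omega), zero_add, zero_add] at e₁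
    rw [e₁] at h
    exact ⟨e₁, by omega⟩
  · intro m
    refine (card_filter_le _ _).trans_lt ?_
    rw [card_powerset, Nat.card_Icc, Nat.add_sub_cancel]
    exact Nat.pow_lt_pow_right (by norm_num) (by omega)

/-- A subset of {1,…,r} has sum at most r², which leaves a missing amount greater than r; adding
that amount as one more part gives a set with sum `n`. -/
theorem two_pow_le_card_setsWithSum {n r : ℕ} (h : (r + 1) ^ 2 ≤ n) : 2 ^ r ≤ #(setsWithSum n) := by
  have hsum : ∀ s ∈ (Icc 1 r).powerset, ∑ i ∈ s, i + r < n := by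
    intro s hs
    have h₁ : ∑ i ∈ s, i ≤ ∑ i ∈ Icc 1 r, i := sum_le_sum_of_subset (mem_powerset.1 hs)
    have h₂ : ∑ i ∈ Icc 1 r, i ≤ ∑ i ∈ Icc 1 r, r :=
      sum_le_sum fun i hi => (mem_Icc.1 hi).2
    rw [sum_const, Nat.card_Icc, smul_eq_mul] at h₂
    simp only [Nat.add_sub_cancel] at h₂
    nlinarith
  have : #(Icc 1 r).powerset = 2 ^ r := by simp
  rw [← this]
  have hnot : ∀ s ∈ (Icc 1 r).powerset, n - ∑ i ∈ s, i ∉ s := by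
    intro s hs h
    have h₁ := hsum s hs
    have h₂ := (mem_Icc.1 (mem_powerset.1 hs h)).2
    omega
  refine card_le_card_of_injOn (fun s => insert (n - ∑ i ∈ s, i) s) ?_ ?_
  · intro s hs
    have h₁ := hsum s hs
    rw [mem_coe, mem_setsWithSum]
    refine ⟨fun i hi => ?_, ?_⟩
    · rcases mem_insert.1 hi with rfl | hi
      · omega
      · exact (mem_Icc.1 (mem_powerset.1 hs hi)).1
    · rw [sum_insert (hnot s hs)]
      omega
  -- The added part exceeds `r`, so the elements up to `r` recover the subset: this is injectivity.
  · have key : ∀ s ∈ (Icc 1 r).powerset,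
        (insert (n - ∑ i ∈ s, i) s).filter (fun i => i ≤ r) = s := by
      intro s hs
      have h₁ := hsum s hs
      rw [filter_insert, if_neg (by omega), filter_eq_self]
      exact fun i hi => (mem_Icc.1 (mem_powerset.1 hs hi)).2
    intro s hs t ht hst
    rw [← key s hs, ← key t ht]
    simp only at hst
    rw [hst]

/-- Take r = ⌊√n⌋ - 1 in the count of sets; every term of the sum is at least 1. This is what makes
time polynomial in `n` acceptable. -/
theorem lt_of_distinctPartsSum {g : ℕ → ℕ} (hg : ∀ k, 1 ≤ k → 1 ≤ g k) {n : ℕ} (hn : 1 ≤ n) :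
    n < (Nat.log 2 (distinctPartsSum g n) + 2) ^ 2 := by
  have h₁ : 2 ^ (Nat.sqrt n - 1) ≤ distinctPartsSum g n := by
    have hs : 1 ≤ Nat.sqrt n := Nat.le_sqrt.2 (by omega)
    refine (two_pow_le_card_setsWithSum (n := n) ?_).trans ?_
    · rw [Nat.sub_add_cancel hs]; exact Nat.sqrt_le' n
    · rw [distinctPartsSum_eq_sum, card_eq_sum_ones]
      refine sum_le_sum fun s hs => hg _ ?_
      rw [Nat.one_le_iff_ne_zero, Ne, card_eq_zero]
      rintro rfl
      simp [mem_setsWithSum] at hs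
      omega
  have h₂ := Nat.le_log_of_pow_le (by norm_num) h₁
  refine (Nat.lt_succ_sqrt' n).trans_le (Nat.pow_le_pow_left ?_ 2)
  rw [Nat.succ_eq_add_one]
  omega

end Counting

namespace StackProgram

/-! ### Repeated addition -/

section Repeat

variable {M : TM2ComputableAux Bool Bool} {R : Type} [DecidableEq R]

/-- Add the binary number in `y` to `a`, with the help of the empty registers `x` and `t`. -/
def addCopy (y a x t : R) : Prog M R := copy y x t ;; addTo a x t

theorem runs_addCopy {y a x t : R} (hyx : y ≠ x) (hyt : y ≠ t) (hax : a ≠ x)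
    (hat : a ≠ t) (hxt : x ≠ t) {s : R → List Bool} (hx : s x = []) (ht : s t = []) :
    Runs (addCopy y a x t : Prog M R) s (Function.update s a (addBits false (s a) (s y)))
      (5 * (s y).length + 3 * max (s a).length (s y).length + 6) := by
  refine ((runs_copy hyx hyt hxt ht).seq (runs_addTo hax hat hxt ?_)).mono ?_ ?_
  · simp [hxt.symm, ht]
  · funext r
    simp only [Function.update_apply]
    split_ifs <;> simp_all
  · simp [hax, hx]; omega

/-- Add the binary number in `y` to `a` as many times as `c` has symbols. -/
def addTimes (c y a x t : R) : Prog M R := loop c (addCopy y a x t) (addCopy y a x t)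

theorem runs_addTimes {c y a x t : R} (hcy : c ≠ y) (hca : c ≠ a) (hcx : c ≠ x) (hct : c ≠ t)
    (hya : y ≠ a) (hyx : y ≠ x) (hyt : y ≠ t) (hax : a ≠ x)
    (hat : a ≠ t) (hxt : x ≠ t) {s : R → List Bool} (hx : s x = []) (ht : s t = []) :
    Runs (addTimes c y a x t : Prog M R) s
      (Function.update (Function.update s c []) a
        ((fun z => addBits false z (s y))^[(s c).length] (s a)))
      ((s c).length * (8 * (max (s a).length (s y).length + (s c).length) + 7) + 1) := by
  induction hc : s c generalizing s with
  | nil =>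
    refine (runs_loop_nil hc).mono ?_ (by simp)
    funext r
    simp only [Function.update_apply]
    split_ifs <;> simp_all
  | cons b l ih =>
    have step := runs_addCopy (M := M) hyx hyt hax hat hxt (s := Function.update s c l)
      (by simp [hcx.symm, hx]) (by simp [hct.symm, ht])
    have hl := length_addBits_le false (s a) (s y)
    refine (runs_loop_cons b hc (by rw [ite_self]; exact step) (ih ?_ ?_ ?_)).mono ?_ ?_
    · simp [hax.symm, hcx.symm, hx]
    · simp [hat.symm, hct.symm, ht]
    · simp [hca]
    · funext r
      simp only [Function.update_apply]
      split_ifs <;> simp_all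
    · simp only [Function.update_self, Function.update_of_ne hcy.symm, Function.update_of_ne hca.symm,
        Function.update_of_ne hya, List.length_cons]
      set m := max (s a).length (s y).length with hm
      have h1 : max (addBits false (s a) (s y)).length (s y).length ≤ m + 1 := by omega
      have h2 : (s y).length ≤ m := by omega
      calc _ ≤ 5 * m + 3 * m + 6 + 1 + (l.length * (8 * (m + 1 + l.length) + 7) + 1) := by gcongr
        _ ≤ _ := by ring_nf; omega

theorem val_iterate_addBits (x y : List Bool) (m : ℕ) :
    val ((fun z => addBits false z y)^[m] x) = val x + m * val y := by
  induction m with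
  | zero => simp
  | succ m ih => rw [Function.iterate_succ_apply', val_addBits, ih, Bool.toNat_false]; ring

theorem length_iterate_addBits_le (x y : List Bool) (m : ℕ) :
    ((fun z => addBits false z y)^[m] x).length ≤ max x.length y.length + m := by
  induction m with
  | zero => simp
  | succ m ih =>
    rw [Function.iterate_succ_apply']
    have := length_addBits_le false ((fun z => addBits false z y)^[m] x) y
    omega

end Repeat

/-! ### From running times to PIO functions -/

theorem outputsWithin_mono {M : TM2ComputableAux Bool Bool} {x y : List Bool} {t t' : ℕ}
    (h : OutputsWithin M x y t) (ht : t ≤ t') : OutputsWithin M x y t' := by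
  obtain ⟨h⟩ := h
  exact ⟨⟨h.toEvalsTo, h.steps_le_m.trans ht⟩⟩

/-- The summand 1 is absorbed by log(1+n) ≥ log 2; the factor 4 generously covers the change of base
by 1/log 2. -/
theorem natLog_le_inOutSize {f : ℕ → ℕ} {n : ℕ} (hn : 1 ≤ n) (hf : 1 ≤ f n) :
    ((Nat.log 2 (f n) + 1 : ℕ) : ℝ) ≤ 4 * inOutSize (fun n => (f n : ℤ)) n := by
  have h₁ : ((2 ^ (Nat.log 2 (f n)) : ℕ) : ℝ) ≤ (f n : ℝ) := by
    exact_mod_cast Nat.pow_log_le_self 2 (by omega)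
  have h₂ : (Nat.log 2 (f n) : ℝ) * Real.log 2 ≤ Real.log (2 + f n) := by
    rw [← Real.log_pow]
    apply Real.log_le_log (by positivity)
    push_cast at h₁
    linarith
  have h₃ : Real.log 2 ≤ Real.log (1 + n) := by
    apply Real.log_le_log (by norm_num)
    have : (1 : ℝ) ≤ n := by exact_mod_cast hn
    linarith
  have h₄ := Real.log_two_gt_d9
  have h₅ : |((f n : ℤ) : ℝ)| = f n := by simp
  unfold inOutSize
  rw [h₅]
  push_cast
  have h₆ : (0 : ℝ) ≤ Nat.log 2 (f n) := by positivity
  nlinarith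

/-- A machine whose running time is polynomial in the output size proves the PIO property. -/
theorem isPIO_of_outputsWithin {f : ℕ → ℕ} (hf : ∀ n, 1 ≤ n → 1 ≤ f n)
    (M : TM2ComputableAux Bool Bool) (C D : ℕ)
    (h : ∀ n, 1 ≤ n → OutputsWithin M (encodeNat n) (encodeInt (f n))
      (C * (Nat.log 2 (f n) + 1) ^ D)) : IsPIO fun n => (f n : ℤ) := by
  -- The summand 1 and the exponent `D + 1` keep both constants positive even if `C` or `D` is zero.
  refine ⟨M, C * 4 ^ (D + 1) + 1, D + 1, by omega, by omega, fun n hn => ⟨_, ?_, h n hn⟩⟩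
  have h₁ := natLog_le_inOutSize hn (hf n hn)
  set m := inOutSize (fun n => (f n : ℤ)) n
  have h₀ : (0 : ℝ) ≤ m := by
    have : (0 : ℝ) ≤ ((Nat.log 2 (f n) + 1 : ℕ) : ℝ) := by positivity
    linarith
  have h₂ : (C * (Nat.log 2 (f n) + 1) ^ D : ℕ) ≤ C * (Nat.log 2 (f n) + 1) ^ (D + 1) :=
    Nat.mul_le_mul_left _ (Nat.pow_le_pow_right (by omega) (by omega))
  calc ((C * (Nat.log 2 (f n) + 1) ^ D : ℕ) : ℝ)
      ≤ ((C * (Nat.log 2 (f n) + 1) ^ (D + 1) : ℕ) : ℝ) := by exact_mod_cast h₂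
    _ = C * ((Nat.log 2 (f n) + 1 : ℕ) : ℝ) ^ (D + 1) := by push_cast; ring
    _ ≤ C * (4 * m) ^ (D + 1) := by gcongr
    _ ≤ ((C * 4 ^ (D + 1) + 1 : ℕ) : ℝ) * m ^ (D + 1) := by
      push_cast
      rw [mul_pow, add_mul, one_mul]
      have : (0 : ℝ) ≤ m ^ (D + 1) := by positivity
      linarith

theorem encodeInt_natCast (n : ℕ) : encodeInt (n : ℤ) = false :: encodeNat n := by
  simp [encodeInt]

theorem length_encodeNat_le (n : ℕ) : (encodeNat n).length ≤ n := by
  rw [length_encodeNat, Nat.size_le]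
  exact n.lt_two_pow_self

/-! ### The factorial -/

/-- The registers of the program for the factorial. -/
inductive FactorialReg
  | inp | out | n | i | c | y | x | a | t
  deriving DecidableEq

instance : Fintype FactorialReg where
  elems := {.inp, .out, .n, .i, .c, .y, .x, .a, .t}
  complete r := by cases r <;> decide

section Factorial

open FactorialReg

variable {M : TM2ComputableAux Bool Bool}

/-- Multiply `a` by one more than the length of `i`, and increase this length. -/
def factorialStep : Prog M FactorialReg :=
  push i true ;; copy i c t ;; move a t ;; move t y ;; addTimes c y a x t ;; clear y

/-- The program for the factorial. -/
def factorialProg : Prog M FactorialReg :=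
  toUnary inp n t ;; push a true ;; loop n factorialStep factorialStep ;; clear i ;;
    trimReg a t ;; move a t ;; move t out ;; push out false

/-- A binary representation of the factorial. -/
def factorialBits : ℕ → List Bool
  | 0 => [true]
  | j + 1 => (fun z => addBits false z (factorialBits j))^[j + 1] []

theorem val_factorialBits (j : ℕ) : val (factorialBits j) = j.factorial := by
  induction j with
  | zero => rfl
  | succ j ih => rw [factorialBits, val_iterate_addBits, ih, Nat.factorial_succ]; simp

/-- The product with `j + 1` takes `j + 1` additions, each lengthening the number by at most one
digit. -/
theorem length_factorialBits_le (j : ℕ) : (factorialBits j).length ≤ 1 + j ^ 2 := by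
  induction j with
  | zero => simp [factorialBits]
  | succ j ih =>
    refine (length_iterate_addBits_le _ _ _).trans ?_
    simp only [List.length_nil]
    rw [max_eq_right (by omega)]
    nlinarith

/-- The state of the registers in the main loop of the factorial program. -/
def factorialState (k j : ℕ) : FactorialReg → List Bool
  | n => List.replicate (k - j) true
  | i => List.replicate j true
  | a => factorialBits j
  | _ => []

theorem runs_factorialStep {k j : ℕ} (hj : j < k) :
    Runs (factorialStep : Prog M FactorialReg)
      (Function.update (factorialState k j) n (List.replicate (k - (j + 1)) true))
      (factorialState k (j + 1)) (30 * (k + 1) ^ 3) := by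
  have hl := length_factorialBits_le j
  have hl' : (factorialBits j).length ≤ 1 + k ^ 2 := by nlinarith
  refine ((runs_push _ _ _).seq ((runs_copy ?_ ?_ ?_ ?_).seq ((runs_move ?_ _).seq
    ((runs_move ?_ _).seq ((runs_addTimes ?_ ?_ ?_ ?_ ?_ ?_ ?_ ?_ ?_ ?_ ?_ ?_).seq
    (runs_clear _ _)))))).mono ?_ ?_
  -- The 18 conditions that registers are distinct or empty precede the goals on the final state and
  -- the time.
  rotate_left 18
  · funext r
    cases r <;> simp [factorialState, factorialBits, List.replicate_succ]
  · simp [factorialState]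
    set l := (factorialBits j).length
    calc _ ≤ 1 + (5 * (k + 1) + 2 + (2 * (1 + k ^ 2) + 1 + (2 * (1 + k ^ 2) + 1 +
          (k * (8 * (1 + k ^ 2 + k) + 7) + 1 + (2 * (1 + k ^ 2) + 1))))) := by
            gcongr <;> omega
      _ ≤ _ := by nlinarith [sq_nonneg k, Nat.zero_le k]
  all_goals simp [factorialState]

theorem runs_factorialProg (k : ℕ) :
    Runs (factorialProg : Prog M FactorialReg)
      (Function.update (fun _ => []) inp (encodeNat k))
      (Function.update (fun _ => []) out (encodeInt (k.factorial : ℕ))) (100 * (k + 1) ^ 4) := by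
  have hloop := runs_loop (M := M) (r := n) (p₀ := factorialStep) (p₁ := factorialStep)
    (30 * (k + 1) ^ 3) k (factorialState k) (by simp [factorialState]) (fun j hj => by
      refine ⟨true, List.replicate (k - (j + 1)) true, ?_, runs_factorialStep hj⟩
      simp only [factorialState]
      rw [← List.replicate_succ]
      congr 1
      omega)
  have hl := length_factorialBits_le k
  have htrim := length_trim_le (factorialBits k)
  have he := length_encodeNat_le k
  refine ((runs_toUnary ?_ ?_ ?_ ?_ ?_).seq (((runs_push _ _ _).mono ?_ le_rfl).seq (hloop.seq
    ((runs_clear _ _).seq ((runs_trimReg ?_ ?_).seq ((runs_move ?_ _).seq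
    ((runs_move ?_ _).seq (runs_push _ _ _)))))))).mono ?_ ?_
  rotate_left 10
  · funext r
    cases r <;> simp [factorialState, encodeInt_natCast, ← encodeNat_val, val_factorialBits]
  · simp [factorialState, val_encodeNat]
    set l := (factorialBits k).length
    set l' := (trim (factorialBits k)).length
    calc _ ≤ k * (7 * k + 6) + 2 + (1 + (k * (30 * (k + 1) ^ 3 + 1) + 1 + (2 * k + 1 +
        (6 * (1 + k ^ 2) + 2 + (2 * (1 + k ^ 2) + 1 + (2 * (1 + k ^ 2) + 1 + 1)))))) := by
          gcongr <;> omega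
      _ ≤ _ := by nlinarith [sq_nonneg k, Nat.zero_le k]
  rotate_right 5
  · funext r
    cases r <;> simp [factorialState, val_encodeNat, factorialBits]
  all_goals simp [factorialState]

theorem isPIO_factorial : IsPIO fun k => (k.factorial : ℤ) := by
  -- The factorial program makes no calls, so any machine serves as the parameter.
  obtain ⟨M₀⟩ : Nonempty (TM2ComputableAux Bool Bool) := ⟨default⟩
  refine isPIO_of_outputsWithin (fun k _ => k.factorial_pos)
    (machine (factorialProg : Prog M₀ FactorialReg) inp out) 1700 4 fun k hk => ?_
  -- With ν = `Nat.log 2 k.factorial + 1`, the bound k! ≥ 2^(k-1) gives k + 1 ≤ 2ν; the time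
  -- 100(k+1)⁴ + 1 is then at most (100·2⁴ + 100)ν⁴, whence 1700.
  have hν : k ≤ Nat.log 2 k.factorial + 1 := by
    have h₁ : 2 ^ (k - 1) ≤ k.factorial := by
      obtain ⟨m, rfl⟩ := Nat.exists_eq_add_of_le' hk
      simpa [add_comm] using Nat.factorial_mul_pow_le_factorial (m := 1) (n := m)
    have := Nat.le_log_of_pow_le (by norm_num) h₁
    omega
  refine outputsWithin_mono (runs_factorialProg (M := M₀) k).outputsWithin ?_
  calc 100 * (k + 1) ^ 4 + 1 ≤ 100 * (2 * (Nat.log 2 k.factorial + 1)) ^ 4 + 100 * 1 ^ 4 := by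
        gcongr <;> omega
    _ ≤ 100 * (2 * (Nat.log 2 k.factorial + 1)) ^ 4 + 100 * (Nat.log 2 k.factorial + 1) ^ 4 := by
        gcongr; omega
    _ = _ := by ring

end Factorial

/-! ### Extracting blocks of digits, and long multiplication -/

section DigitPrograms

variable {M : TM2ComputableAux Bool Bool} {R : Type} [DecidableEq R]

/-- Pop the register `z` as many times as `c` has symbols. -/
def dropTimes (c z : R) : Prog M R :=
  loop c (popCases z skip skip skip) (popCases z skip skip skip)

theorem runs_pop (z : R) (s : R → List Bool) :
    Runs (popCases z skip skip skip : Prog M R) s (Function.update s z (s z).tail) 2 := by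
  cases hz : s z with
  | nil =>
    refine (runs_popCases_nil hz (runs_skip _)).mono ?_ le_rfl
    rw [List.tail_nil, ← hz, Function.update_eq_self]
  | cons b x =>
    refine runs_popCases_cons b hz ?_
    rw [ite_self]
    exact runs_skip _

theorem runs_dropTimes {c z : R} (h : c ≠ z) (s : R → List Bool) :
    Runs (dropTimes c z : Prog M R) s
      (Function.update (Function.update s c []) z ((s z).drop (s c).length))
      (3 * (s c).length + 1) := by
  induction hc : s c generalizing s with
  | nil =>
    refine (runs_loop_nil hc).mono ?_ (by simp)
    funext r
    simp only [Function.update_apply]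
    split_ifs <;> simp_all
  | cons b l ih =>
    refine (runs_loop_cons b hc (by rw [ite_self]; exact runs_pop z _) (ih _ ?_)).mono ?_ ?_
    · simp [h]
    · funext r
      simp only [Function.update_apply]
      split_ifs <;> simp_all
    · simp; omega

/-- Move the first digits of `z` to `q`, as many as `c` has symbols, and push a symbol on `f` for
every digit that is not zero. -/
def takeDigits (c z q f : R) : Prog M R :=
  loop c (popCases z (push q false) (push q false) (push q true ;; push f true))
    (popCases z (push q false) (push q false) (push q true ;; push f true))

/-- An exhausted `z` supplies zeros, in accordance with `digits`. Since `f` gets a mark for each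
digit 1, it stays empty exactly on a zero block if it was empty before. -/
theorem runs_takeDigit {z q f : R} (hzq : z ≠ q) (hzf : z ≠ f) (hqf : q ≠ f) (s : R → List Bool) :
    Runs (popCases z (push q false) (push q false) (push q true ;; push f true) : Prog M R) s
      (Function.update (Function.update (Function.update s z (s z).tail) q
        ((s z).head?.getD false :: s q)) f
        (List.replicate ([(s z).head?.getD false].count true) true ++ s f)) 3 := by
  cases hz : s z with
  | nil =>
    refine (runs_popCases_nil hz (runs_push _ _ _)).mono ?_ (by omega)
    funext r
    simp only [Function.update_apply]
    split_ifs <;> simp_all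
  | cons b x =>
    cases b
    · refine (runs_popCases_cons false hz (runs_push _ _ _)).mono ?_ (by omega)
      funext r
      simp only [Function.update_apply]
      split_ifs <;> simp_all
    · refine (runs_popCases_cons true hz ((runs_push _ _ _).seq (runs_push _ _ _))).mono ?_
        (by omega)
      funext r
      simp only [Function.update_apply]
      split_ifs <;> simp_all

theorem runs_takeDigits {c z q f : R} (hcz : c ≠ z) (hcq : c ≠ q) (hcf : c ≠ f) (hzq : z ≠ q)
    (hzf : z ≠ f) (hqf : q ≠ f) (s : R → List Bool) :
    Runs (takeDigits c z q f : Prog M R) s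
      (Function.update (Function.update (Function.update (Function.update s c []) z
        ((s z).drop (s c).length)) q ((digits (s c).length (s z)).reverse ++ s q)) f
        (List.replicate ((digits (s c).length (s z)).count true) true ++ s f))
      (4 * (s c).length + 1) := by
  induction hc : s c generalizing s with
  | nil =>
    refine (runs_loop_nil hc).mono ?_ (by simp)
    funext r
    simp only [Function.update_apply]
    split_ifs <;> simp_all [digits]
  | cons b l ih =>
    refine (runs_loop_cons b hc (by rw [ite_self]; exact runs_takeDigit hzq hzf hqf _)
      (ih _ ?_)).mono ?_ ?_
    · simp [hcf, hcq, hcz]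
    · funext r
      simp only [Function.update_apply]
      split_ifs <;> simp_all [digits]
      rw [← List.append_assoc, ← List.replicate_add, List.count_cons, List.count_cons,
        List.count_nil, zero_add]
    · simp; omega

/-- The result of multiplying `y` by a number with given digits, and adding it to `a`. -/
def mulBits : List Bool → List Bool → List Bool → List Bool
  | [], _, a => a
  | b :: g, y, a => mulBits g (false :: y) (if b then addBits false a y else a)

theorem val_mulBits (g y a : List Bool) : val (mulBits g y a) = val a + val g * val y := by
  induction g generalizing y a with
  | nil => simp [mulBits]
  | cons b g ih =>
    rw [mulBits, ih]
    cases b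
    · simp; ring
    · simp [val_addBits]; ring

/-- Each digit of `g` lengthens the shifted `y` by one, and an addition exceeds the longer summand
by at most one digit. -/
theorem length_mulBits_le (g y a : List Bool) :
    (mulBits g y a).length ≤ max a.length y.length + g.length := by
  induction g generalizing y a with
  | nil => simp [mulBits]
  | cons b g ih =>
    rw [mulBits]
    refine (ih _ _).trans ?_
    have := length_addBits_le false a y
    cases b <;> simp <;> omega

/-- Multiply the binary numbers in `g` and `y`, and add the product to `a`. -/
def mulTo (g y a x t : R) : Prog M R :=
  loop g (push y false) (addCopy y a x t ;; push y false)

/-- The multiplicand is shifted in place, so `y` keeps it with additional zeros, to be cleared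
afterwards. -/
theorem runs_mulTo {g y a x t : R} (hgy : g ≠ y) (hga : g ≠ a) (hgx : g ≠ x) (hgt : g ≠ t)
    (hya : y ≠ a) (hyx : y ≠ x) (hyt : y ≠ t) (hax : a ≠ x)
    (hat : a ≠ t) (hxt : x ≠ t) {s : R → List Bool} (hx : s x = []) (ht : s t = []) :
    Runs (mulTo g y a x t : Prog M R) s
      (Function.update (Function.update (Function.update s g []) y
        (List.replicate (s g).length false ++ s y)) a (mulBits (s g) (s y) (s a)))
      ((s g).length * (8 * (max (s a).length (s y).length + (s g).length) + 8) + 1) := by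
  induction hg : s g generalizing s with
  | nil =>
    refine (runs_loop_nil hg).mono ?_ (by simp)
    funext r
    simp only [Function.update_apply]
    split_ifs <;> simp_all [mulBits]
  | cons b l ih =>
    have step : Runs (if b then addCopy y a x t ;; push y false else push y false : Prog M R)
        (Function.update s g l)
        (Function.update (Function.update (Function.update s g l) y (false :: s y)) a
          (if b then addBits false (s a) (s y) else s a))
        (8 * max (s a).length (s y).length + 7) := by
      cases b
      · refine (runs_push _ _ _).mono ?_ (by omega)
        funext r
        simp only [Function.update_apply]
        split_ifs <;> simp_all
      · refine ((runs_addCopy hyx hyt hax hat hxt ?_ ?_).seq (runs_push _ _ _)).mono ?_ ?_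
        · simp [hgx.symm, hx]
        · simp [hgt.symm, ht]
        · funext r
          simp only [Function.update_apply]
          split_ifs <;> simp_all
        · simp only [Function.update_of_ne hgy.symm, Function.update_of_ne hga.symm]
          omega
    refine (runs_loop_cons b hg step (ih ?_ ?_ ?_)).mono ?_ ?_
    · simp [hax.symm, hyx.symm, hgx.symm, hx]
    · simp [hat.symm, hyt.symm, hgt.symm, ht]
    · simp [hga, hgy]
    · funext r
      simp only [Function.update_apply]
      split_ifs <;> simp_all [mulBits, List.replicate_succ']
    · have hl := length_addBits_le false (s a) (s y)
      simp only [Function.update_self, Function.update_of_ne hya, List.length_cons]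
      set m := max (s a).length (s y).length with hm
      have h1 : max (if b then addBits false (s a) (s y) else s a).length ((s y).length + 1) ≤
          m + 1 := by
        cases b <;> simp <;> omega
      calc _ ≤ 8 * m + 7 + 1 + (l.length * (8 * (m + 1 + l.length) + 8) + 1) := by gcongr
        _ ≤ _ := by ring_nf; omega

end DigitPrograms

/-! ### Sums over partitions into distinct parts -/

/-- The registers of the program for sums over partitions into distinct parts. -/
inductive PartitionReg
  | inp | out | n | b | w | s | z | y | c | f | q | k | g | x | a | t
  deriving DecidableEq

instance : Fintype PartitionReg where
  elems := {.inp, .out, .n, .b, .w, .s, .z, .y, .c, .f, .q, .k, .g, .x, .a, .t}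
  complete r := by cases r <;> decide

section Partitions

open PartitionReg

variable {M : TM2ComputableAux Bool Bool}

/-- A unary number. -/
abbrev unary (m : ℕ) : List Bool := List.replicate m true

theorem unary_sub {m j : ℕ} (h : j < m) : unary (m - j) = true :: unary (m - (j + 1)) := by
  rw [unary, unary, ← List.replicate_succ]
  congr 1
  omega

/-- The binary digits of the product that contains the numbers of partitions. -/
def prodBits (N : ℕ) : ℕ → List Bool
  | 0 => [true]
  | i + 1 => addBits false (prodBits N i)
      (List.replicate ((N + 1) + (N + 1) ^ 2 * (i + 1)) false ++ prodBits N i)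

theorem val_prodBits (N i : ℕ) :
    val (prodBits N i) = ∏ j ∈ Finset.Icc 1 i, (1 + 2 ^ ((N + 1) + (N + 1) ^ 2 * j)) := by
  induction i with
  | zero => simp [prodBits]
  | succ i ih =>
    rw [prodBits, val_addBits, val_append, val_replicate_false, List.length_replicate, ih,
      Finset.prod_Icc_succ_top (by omega), Bool.toNat_false]
    ring

/-- The factor 1 + 2^e is a shift by e ≤ U³ followed by an addition, so it contributes at most U³ +
1 digits. -/
theorem length_prodBits_le {N U : ℕ} (hU : N + 1 ≤ U) {i : ℕ} (hi : i ≤ N) :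
    (prodBits N i).length ≤ 1 + i * (U ^ 3 + 1) := by
  induction i with
  | zero => simp [prodBits]
  | succ i ih =>
    have := ih (by omega)
    refine (length_addBits_le _ _ _).trans ?_
    rw [List.length_append, List.length_replicate, max_eq_right (by omega)]
    have h₁ : (N + 1) + (N + 1) ^ 2 * (i + 1) ≤ U ^ 3 := by
      calc _ ≤ (N + 1) ^ 2 + (N + 1) ^ 2 * N := by gcongr; nlinarith
        _ = (N + 1) ^ 3 := by ring
        _ ≤ _ := by gcongr
    rw [add_mul, one_mul]
    omega

/-- The digits of the number of partitions into `j + 1` distinct parts. -/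
def countDigits (N j : ℕ) : List Bool :=
  digits (N + 1) ((prodBits N N).drop ((N + 1) + (N + 1) ^ 2 * N + (N + 1) * j))

/-- The position (N+1)(k + (N+1)N) from `prod_div_mod` at k = j + 1, split so that the part
independent of `j` can be dropped beforehand. -/
theorem val_countDigits {N j : ℕ} (hj : j < N) :
    val (countDigits N j) = numDistinctPartitions (j + 1) N := by
  rw [countDigits, val_digits, val_drop, val_prodBits, ← prod_div_mod (n := N) (k := j + 1) hj]
  congr 3
  ring

/-- The digits of a partial sum. -/
def sumBits (G : ℕ → ℕ) (N : ℕ) : ℕ → List Bool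
  | 0 => []
  | j + 1 => if (countDigits N j).count true = 0 then sumBits G N j
      else mulBits (encodeNat (G (j + 1))) (countDigits N j) (sumBits G N j)

theorem val_sumBits (G : ℕ → ℕ) {N j : ℕ} (hj : j ≤ N) :
    val (sumBits G N j) = ∑ i ∈ Finset.Icc 1 j, G i * numDistinctPartitions i N := by
  induction j with
  | zero => simp [sumBits]
  | succ j ih =>
    rw [Finset.sum_Icc_succ_top (by omega), ← ih (by omega), ← val_countDigits (by omega), sumBits]
    split_ifs with h
    · rw [← val_eq_zero_iff] at h
      simp [h]
    · rw [val_mulBits, val_encodeNat]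

/-- A bound on `G k` is needed only where the count is nonzero, other terms being skipped. A product
adds at most `U` digits to the longer of the sum and the block of N + 1 ≤ U digits. -/
theorem length_sumBits_le {G : ℕ → ℕ} {N U : ℕ} (hU : N + 1 ≤ U)
    (hG : ∀ k, 1 ≤ k → k ≤ N → numDistinctPartitions k N ≠ 0 → (encodeNat (G k)).length ≤ U)
    {j : ℕ} (hj : j ≤ N) : (sumBits G N j).length ≤ 2 * U * j := by
  induction j with
  | zero => simp [sumBits]
  | succ j ih =>
    have := ih (by omega)
    rw [sumBits]
    split_ifs with h
    · rw [mul_add]; omega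
    · rw [← val_eq_zero_iff, val_countDigits (by omega)] at h
      have := hG (j + 1) (by omega) hj h
      refine (length_mulBits_le _ _ _).trans ?_
      have : (countDigits N j).length = N + 1 := length_digits _ _
      rw [mul_add]
      omega

/-- Set up the constants. -/
def setup : Prog M PartitionReg :=
  toUnary inp n t ;; copy n b t ;; push b true ;; copy b c t ;;
    -- `w` collects N + 1 copies of `b`, hence has length (N+1)². Then `s` starts at length N + 1
    -- and grows by `w` before each factor, giving the exponents of the product.
    loop c (copy b w t) (copy b w t) ;; copy b s t ;; push z true ;; copy n c t

/-- The state of the registers while the square is computed. -/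
def squareState (N i : ℕ) : PartitionReg → List Bool
  | n => unary N
  | b => unary (N + 1)
  | c => unary (N + 1 - i)
  | w => unary ((N + 1) * i)
  | _ => []

/-- The state of the registers while the product is computed. -/
def prodState (N i : ℕ) : PartitionReg → List Bool
  | n => unary N
  | b => unary (N + 1)
  | c => unary (N - i)
  | w => unary ((N + 1) ^ 2)
  | s => unary ((N + 1) + (N + 1) ^ 2 * i)
  | z => prodBits N i
  | _ => []

/-- The state of the registers while the sum is computed. -/
def sumState (G : ℕ → ℕ) (N j : ℕ) : PartitionReg → List Bool
  | n => unary (N - j)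
  | b => unary (N + 1)
  | z => (prodBits N N).drop ((N + 1) + (N + 1) ^ 2 * N + (N + 1) * j)
  | k => encodeNat j
  | a => sumBits G N j
  | _ => []

theorem runs_setup {N U : ℕ} (hU : N + 1 ≤ U) :
    Runs (setup : Prog M PartitionReg) (Function.update (fun _ => []) inp (encodeNat N))
      (prodState N 0) (60 * U ^ 2) := by
  have hloop := runs_loop (M := M) (r := c) (p₀ := copy b w t) (p₁ := copy b w t)
    (5 * (N + 1) + 2) (N + 1) (squareState N) (by simp [squareState]) (fun j hj => by
      refine ⟨true, _, unary_sub hj, ?_⟩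
      refine (runs_copy ?_ ?_ ?_ ?_).mono ?_ ?_
      rotate_left 4
      · funext r
        cases r <;> simp [squareState, mul_add, add_comm]
      all_goals simp [squareState])
  have he := length_encodeNat_le N
  refine ((runs_toUnary ?_ ?_ ?_ ?_ ?_).seq ((runs_copy ?_ ?_ ?_ ?_).seq ((runs_push _ _ _).seq
    (((runs_copy ?_ ?_ ?_ ?_).mono ?_ le_rfl).seq (hloop.seq ((runs_copy ?_ ?_ ?_ ?_).seq
    ((runs_push _ _ _).seq (runs_copy ?_ ?_ ?_ ?_)))))))).mono ?_ ?_
  case refine_23 =>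
    funext r
    cases r <;> simp [squareState, prodState, prodBits, pow_two]
  case refine_24 =>
    simp [squareState, val_encodeNat]
    calc _ ≤ U * (7 * U + 6) + 2 + (5 * U + 2 + (1 + (5 * U + 2 + (U * (5 * U + 2 + 1) + 1 +
        (5 * U + 2 + (1 + (5 * U + 2))))))) := by gcongr <;> omega
      _ ≤ _ := by nlinarith
  case refine_14 =>
    funext r
    cases r <;> simp [squareState, val_encodeNat, List.replicate_succ]
  all_goals simp [squareState]

/-- Multiply the product by one more factor. -/
def prodStep : Prog M PartitionReg :=
  copy w s t ;; copy z y t ;; copy s x t ;; pushTimes x y false ;; addTo z y t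

theorem runs_prodStep {N U i : ℕ} (hU : N + 1 ≤ U) (hi : i < N) :
    Runs (prodStep : Prog M PartitionReg)
      (Function.update (prodState N i) c (unary (N - (i + 1)))) (prodState N (i + 1))
      (100 * U ^ 4) := by
  have hl := length_prodBits_le hU hi.le
  refine ((runs_copy ?_ ?_ ?_ ?_).seq ((runs_copy ?_ ?_ ?_ ?_).seq ((runs_copy ?_ ?_ ?_ ?_).seq
    ((runs_pushTimes ?_ _ _).seq (runs_addTo ?_ ?_ ?_ ?_))))).mono ?_ ?_
  case refine_18 =>
    funext r
    cases r <;> simp [prodState, prodBits, mul_add] <;> ring_nf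
  case refine_19 =>
    simp [prodState]
    set l := (prodBits N i).length
    have h₁ : l ≤ 2 * U ^ 4 := by
      calc l ≤ 1 + i * (U ^ 3 + 1) := hl
        _ ≤ 1 + (U - 1) * (U ^ 3 + 1) := by gcongr; omega
        _ ≤ U * (U ^ 3 + 1) := by
          obtain ⟨V, rfl⟩ : ∃ V, U = V + 1 := ⟨U - 1, by omega⟩
          simp only [Nat.add_sub_cancel]; ring_nf; omega
        _ ≤ U * (U ^ 3 + U ^ 3) := by gcongr; exact Nat.one_le_pow _ _ (by omega)
        _ = _ := by ring
    have h₂ : (N + 1) ^ 2 + (N + 1 + (N + 1) ^ 2 * i) ≤ U ^ 3 := by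
      calc _ ≤ (N + 1) ^ 2 + ((N + 1) + (N + 1) ^ 2 * (N - 1)) := by gcongr; omega
        _ ≤ (N + 1) ^ 3 := by
          obtain ⟨V, rfl⟩ : ∃ V, N = V + 1 := ⟨N - 1, by omega⟩
          simp only [Nat.add_sub_cancel]; ring_nf; omega
        _ ≤ _ := by gcongr
    have h₃ : (N + 1) ^ 2 ≤ U ^ 3 := by omega
    have h₄ : U ^ 3 ≤ U ^ 4 := Nat.pow_le_pow_right (by omega) (by omega)
    have h₅ : 1 ≤ U ^ 3 := Nat.one_le_pow _ _ (by omega)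
    omega
  all_goals simp [prodState]

/-- Go on to the next number of parts, and read the number of partitions. -/
def fetchStep : Prog M PartitionReg :=
  push x true ;; addTo k x t ;; trimReg k t ;; copy b c t ;; takeDigits c z q f ;; move q y

/-- The state of the registers after the number of partitions has been read. -/
def fetchState (G : ℕ → ℕ) (N j : ℕ) : PartitionReg → List Bool
  | n => unary (N - (j + 1))
  | b => unary (N + 1)
  | z => (prodBits N N).drop ((N + 1) + (N + 1) ^ 2 * N + (N + 1) * (j + 1))
  | k => encodeNat (j + 1)
  | a => sumBits G N j
  | y => countDigits N j
  | f => unary ((countDigits N j).count true)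
  | _ => []

theorem runs_fetchStep {G : ℕ → ℕ} {N U j : ℕ} (hU : N + 1 ≤ U) (hj : j < N) :
    Runs (fetchStep : Prog M PartitionReg)
      (Function.update (sumState G N j) n (unary (N - (j + 1)))) (fetchState G N j)
      (60 * U) := by
  have he := length_encodeNat_le j
  have ha := length_addBits_le false (encodeNat j) [true]
  refine ((runs_push _ _ _).seq ((runs_addTo ?_ ?_ ?_ ?_).seq ((runs_trimReg ?_ ?_).seq
    ((runs_copy ?_ ?_ ?_ ?_).seq ((runs_takeDigits ?_ ?_ ?_ ?_ ?_ ?_ _).seq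
    (runs_move ?_ _)))))).mono ?_ ?_
  case refine_18 =>
    funext r
    cases r <;> simp [sumState, fetchState, ← encodeNat_val, val_addBits, val_encodeNat,
      countDigits, mul_add, add_assoc]
  case refine_19 =>
    simp [sumState] at ha ⊢
    omega
  all_goals simp [sumState]

/-- Multiply the number of partitions by the value of the given function. -/
def accumulate : Prog M PartitionReg :=
  -- An empty `f` means q_k(n) = 0: then the machine must not be called, as `g k` may be too large.
  -- Otherwise the call returns a sign bit first, which is popped before the multiplication.
  popCases f skip skip
    (clear f ;; copy k x t ;; call x g t ;; popCases g skip skip skip ;; mulTo g y a x t)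

/-- Add one more term to the sum. -/
def sumStep : Prog M PartitionReg := fetchStep ;; accumulate ;; clear y

theorem runs_sumStep {G : ℕ → ℕ} {N U τ j : ℕ} (hU : N + 1 ≤ U) (hj : j < N)
    (hG : ∀ k, 1 ≤ k → k ≤ N → numDistinctPartitions k N ≠ 0 → (encodeNat (G k)).length ≤ U ∧
      OutputsWithin M (encodeNat k) (encodeInt (G k : ℕ)) τ) :
    Runs (sumStep : Prog M PartitionReg)
      (Function.update (sumState G N j) n (unary (N - (j + 1)))) (sumState G N (j + 1))
      (200 * U ^ 3 + τ) := by
  have hlen : (countDigits N j).length = N + 1 := length_digits _ _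
  have hU₃ : U ≤ U ^ 3 := Nat.le_self_pow (by norm_num) U
  refine ((runs_fetchStep hU hj).seq ?_ (t' := 120 * U ^ 3 + τ)).mono rfl (by omega)
  by_cases h : (countDigits N j).count true = 0
  · refine ((runs_popCases_nil ?_ (runs_skip _)).seq (runs_clear _ _)).mono ?_ ?_
    · simp [fetchState, h]
    · funext r
      cases r <;> simp [sumState, fetchState, sumBits, h]
    · simp [fetchState, hlen]
      omega
  · obtain ⟨m, hm⟩ := Nat.exists_eq_succ_of_ne_zero h
    have h' := h
    rw [← val_eq_zero_iff, val_countDigits hj] at h'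
    obtain ⟨h₁, h₂⟩ := hG (j + 1) (by omega) hj h'
    have hs := length_sumBits_le hU (fun k hk hk' h => (hG k hk hk' h).1) hj.le
    have hmle : m + 1 ≤ N + 1 := by
      rw [← hlen, ← Nat.succ_eq_add_one, ← hm]
      exact List.count_le_length
    have he := length_encodeNat_le (j + 1)
    rw [encodeInt_natCast] at h₂
    refine ((runs_popCases_cons true (x := unary m) ?_ ((runs_clear _ _).seq
      ((runs_copy ?_ ?_ ?_ ?_).seq ((runs_call (j := false :: encodeNat (G (j + 1))) (u := τ)
      ?_ ?_ ?_ ?_ ?_).seq ((runs_pop _ _).seq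
      (runs_mulTo ?_ ?_ ?_ ?_ ?_ ?_ ?_ ?_ ?_ ?_ ?_ ?_)))))).seq (runs_clear _ _)).mono ?_ ?_
    case refine_23 =>
      funext r
      cases r <;> simp [sumState, fetchState, sumBits, h]
    case refine_24 =>
      simp [fetchState, hlen]
      set l := (encodeNat (G (j + 1))).length
      set l' := (encodeNat (j + 1)).length
      have h₃ : max (sumBits G N j).length (N + 1) ≤ 2 * U ^ 2 := by
        rw [pow_two]
        refine max_le (hs.trans ?_) ?_
        · rw [mul_assoc]; gcongr; omega
        · nlinarith
      calc _ ≤ 2 * U + 1 + (5 * U + 2 + (3 * U + τ + 3 * (U + 1) + 4 + (2 +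
            (U * (8 * (2 * U ^ 2 + U) + 8) + 1)))) + 1 + (2 * (U + U) + 1) := by
            gcongr <;> omega
        _ ≤ _ := by
          have e₁ : U * (8 * (2 * U ^ 2 + U) + 8) = 16 * U ^ 3 + 8 * U ^ 2 + 8 * U := by ring
          have e₂ : U ^ 2 ≤ U ^ 3 := Nat.pow_le_pow_right (by omega) (by norm_num)
          omega
    case refine_1 => simp [fetchState, hm, List.replicate_succ]
    case refine_10 => simpa [fetchState] using h₂
    all_goals simp [fetchState]

/-- The program for sums over partitions into distinct parts. -/
def partitionProg : Prog M PartitionReg :=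
  -- After the product loop, `s` has length (N+1) + (N+1)²N, the bit position of the digit for k =
  -- 1. Dropping that many bits leaves the successive q_k(N) as blocks of N + 1 bits.
  setup ;; loop c prodStep prodStep ;; dropTimes s z ;; clear w ;; loop n sumStep sumStep ;;
    clear b ;; clear z ;; clear k ;; trimReg a t ;; move a t ;; move t out ;; push out false

theorem runs_partitionProg {G : ℕ → ℕ} {N U τ : ℕ} (hN : 1 ≤ N) (hU : N + 1 ≤ U)
    (hG : ∀ k, 1 ≤ k → k ≤ N → numDistinctPartitions k N ≠ 0 → (encodeNat (G k)).length ≤ U ∧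
      OutputsWithin M (encodeNat k) (encodeInt (G k : ℕ)) τ) :
    Runs (partitionProg : Prog M PartitionReg) (Function.update (fun _ => []) inp (encodeNat N))
      (Function.update (fun _ => []) out (encodeInt (distinctPartsSum G N : ℕ)))
      (1000 * U ^ 5 + U * τ) := by
  have hprod := runs_loop (M := M) (r := c) (p₀ := prodStep) (p₁ := prodStep)
    (100 * U ^ 4) N (prodState N) (by simp [prodState]) (fun j hj => by
      refine ⟨true, _, unary_sub hj, ?_⟩
      rw [ite_self]
      exact runs_prodStep hU hj)
  have hsum := runs_loop (M := M) (r := n) (p₀ := sumStep) (p₁ := sumStep)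
    (200 * U ^ 3 + τ) N (sumState G N) (by simp [sumState]) (fun j hj => by
      refine ⟨true, _, unary_sub hj, ?_⟩
      rw [ite_self]
      exact runs_sumStep hU hj hG)
  have htrim : trim (sumBits G N N) = encodeNat (distinctPartsSum G N) := by
    rw [← encodeNat_val, val_sumBits G le_rfl, distinctPartsSum_eq_sum_Icc G hN]
  have hs := length_sumBits_le hU (fun k hk hk' h => (hG k hk hk' h).1) le_rfl
  have htl := length_trim_le (sumBits G N N)
  have hz := length_prodBits_le hU le_rfl
  have he := length_encodeNat_le N
  refine ((runs_setup hU).seq (hprod.seq ((runs_dropTimes ?_ _).seq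
    (((runs_clear _ _).mono ?_ le_rfl).seq (hsum.seq ((runs_clear _ _).seq ((runs_clear _ _).seq
    ((runs_clear _ _).seq ((runs_trimReg ?_ ?_).seq ((runs_move ?_ _).seq
    ((runs_move ?_ _).seq (runs_push _ _ _)))))))))))).mono ?_ ?_
  case refine_2 =>
    funext r
    cases r <;> simp [sumState, prodState, sumBits, encodeNat_eq_bits]
  case refine_7 =>
    funext r
    cases r <;> simp [sumState, encodeInt_natCast, htrim]
  case refine_8 =>
    simp [sumState, prodState]
    have h₁ : N + 1 + (N + 1) ^ 2 * N ≤ U ^ 3 := by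
      calc _ ≤ (N + 1) ^ 3 := by ring_nf; omega
        _ ≤ _ := by gcongr
    have h₂ : (N + 1) ^ 2 ≤ U ^ 2 := by gcongr
    have h₃ : N * (100 * U ^ 4 + 1) ≤ U * (100 * U ^ 4 + 1) := by gcongr; omega
    have h₄ : N * (200 * U ^ 3 + τ + 1) ≤ U * (200 * U ^ 3 + τ + 1) := by gcongr; omega
    have h₅ : N * (U ^ 3 + 1) ≤ U * (U ^ 3 + 1) := by gcongr; omega
    have h₆ : 2 * U * N ≤ 2 * U * U := by gcongr; omega
    have e₁ : U * (100 * U ^ 4 + 1) = 100 * U ^ 5 + U := by ring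
    have e₂ : U * (200 * U ^ 3 + τ + 1) = 200 * U ^ 4 + U * τ + U := by ring
    have e₃ : U * (U ^ 3 + 1) = U ^ 4 + U := by ring
    have e₄ : 2 * U * U = 2 * U ^ 2 := by ring
    have p : ∀ i ≤ 5, U ^ i ≤ U ^ 5 := fun i hi => Nat.pow_le_pow_right (by omega) hi
    have p₀ := p 0 (by omega)
    have p₁ := p 1 (by omega)
    have p₂ := p 2 (by omega)
    have p₃ := p 3 (by omega)
    have p₄ := p 4 (by omega)
    rw [pow_zero] at p₀
    rw [pow_one] at p₁
    omega
  all_goals simp [sumState]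

/-- Crudely log(1+k) ≤ n, which is below (log₂ F + 2)², and log(2 + g k) ≤ log₂ F + 3 up to rounding
of log₂; so a call on `k` is cheap in terms of the output `F`. -/
theorem inOutSize_le {g : ℕ → ℕ} {k n F : ℕ} (hk : k ≤ n) (hg : g k ≤ F) (hF : 1 ≤ F)
    (hn : n < (Nat.log 2 F + 2) ^ 2) :
    inOutSize (fun k => (g k : ℤ)) k ≤ (8 * (Nat.log 2 F + 1) ^ 2 : ℕ) := by
  set ν := Nat.log 2 F
  have h₁ : Real.log (1 + k) ≤ n := by
    have h := Real.log_le_sub_one_of_pos (x := 1 + k) (by positivity)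
    have : (k : ℝ) ≤ n := by exact_mod_cast hk
    linarith
  have h₂ : Real.log (2 + g k) ≤ ν + 3 := by
    have h : (2 + g k : ℕ) ≤ 2 ^ (ν + 3) := by
      have := Nat.lt_pow_succ_log_self (b := 2) (by norm_num) F
      have h2 : 2 ^ (ν + 3) = 4 * 2 ^ (ν + 1) := by ring
      change F < 2 ^ (ν + 1) at this
      omega
    have h' : (2 + g k : ℝ) ≤ 2 ^ (ν + 3) := by exact_mod_cast h
    calc Real.log (2 + g k) ≤ Real.log (2 ^ (ν + 3)) := Real.log_le_log (by positivity) h'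
      _ = ((ν + 3 : ℕ) : ℝ) * Real.log 2 := by rw [Real.log_pow]
      _ ≤ ((ν + 3 : ℕ) : ℝ) * 1 := by
        gcongr
        have := Real.log_two_lt_d9
        linarith
      _ = _ := by push_cast; ring
  have h₃ : |((g k : ℤ) : ℝ)| = g k := by simp
  have h₄ : n + (ν + 3) ≤ 8 * (ν + 1) ^ 2 := by nlinarith
  unfold inOutSize
  rw [h₃]
  calc Real.log (1 + k) + Real.log (2 + g k) ≤ n + (ν + 3) := add_le_add h₁ h₂
    _ ≤ _ := by exact_mod_cast h₄

theorem isPIO_distinctPartsSum {g : ℕ → ℕ} (hg : ∀ k, 1 ≤ k → 1 ≤ g k)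
    (h : IsPIO fun k => (g k : ℤ)) (hpos : ∀ n, 1 ≤ n → 1 ≤ distinctPartsSum g n) :
    IsPIO fun n => (distinctPartsSum g n : ℤ) := by
  obtain ⟨M₀, e, d, -, -, hM₀⟩ := h
  refine isPIO_of_outputsWithin hpos (machine (partitionProg : Prog M₀ PartitionReg) inp out)
    (1000 * 4 ^ 5 + 4 * e * 8 ^ d + 1) (10 + 2 * d) fun n hn => ?_
  set F := distinctPartsSum g n with hF
  have hlt := lt_of_distinctPartsSum hg hn
  rw [← hF] at hlt
  set ν := Nat.log 2 F + 1 with hν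
  have hν₁ : 1 ≤ ν := by omega
  -- Here n + 1 ≤ (ν+1)² ≤ 4ν² gives `U`, and `inOutSize_le` gives `τ`. Substituted in 1000U⁵ + Uτ +
  -- 1, they produce the announced constants, with all powers of ν raised to 10 + 2d.
  refine outputsWithin_mono (runs_partitionProg (G := g) (U := 4 * ν ^ 2)
    (τ := e * (8 * ν ^ 2) ^ d) hn ?_ fun k hk hkn hq => ?_).outputsWithin ?_
  · have : n < (ν + 1) ^ 2 := hlt
    nlinarith
  -- Since q_k(n) ≠ 0, the value `g k` is at most its own term in the sum `F`.
  · have hle : g k ≤ F := by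
      rw [hF, distinctPartsSum_eq_sum_Icc g hn]
      refine le_trans ?_ (Finset.single_le_sum
        (f := fun k => g k * numDistinctPartitions k n) (fun _ _ => Nat.zero_le _)
        (Finset.mem_Icc.2 ⟨hk, hkn⟩))
      exact Nat.le_mul_of_pos_right _ (Nat.pos_of_ne_zero hq)
    constructor
    · have : (encodeNat (g k)).length ≤ ν := by
        rw [length_encodeNat, Nat.size_le]
        exact hle.trans_lt (Nat.lt_pow_succ_log_self (by norm_num) F)
      nlinarith
    · obtain ⟨t, ht, hout⟩ := hM₀ k hk
      refine outputsWithin_mono hout ?_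
      have hsize := inOutSize_le (g := g) hkn hle (hpos n hn) hlt
      have h₀ : 0 ≤ inOutSize (fun k => (g k : ℤ)) k := by
        have := natLog_le_inOutSize (f := g) hk (hg k hk)
        have h' : (0 : ℝ) ≤ ((Nat.log 2 (g k) + 1 : ℕ) : ℝ) := by positivity
        linarith
      have : (t : ℝ) ≤ ((e * (8 * ν ^ 2) ^ d : ℕ) : ℝ) := by
        refine ht.trans ?_
        rw [Nat.cast_mul, Nat.cast_pow]
        gcongr
      exact_mod_cast this
  · have e₁ : 1000 * (4 * ν ^ 2) ^ 5 + 4 * ν ^ 2 * (e * (8 * ν ^ 2) ^ d) + 1 =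
        1000 * 4 ^ 5 * ν ^ 10 + 4 * e * 8 ^ d * ν ^ (2 + 2 * d) + 1 * ν ^ 0 := by
      rw [mul_pow, mul_pow, ← pow_mul, ← pow_mul, pow_add, pow_zero]; ring
    rw [e₁, add_mul, add_mul]
    gcongr <;> omega

end Partitions

end StackProgram

open StackProgram in
theorem mainTheorem12 :
    (∀ g : ℕ → ℕ, (∀ k : ℕ, 1 ≤ k → 1 ≤ g k) → IsPIO (fun k => (g k : ℤ)) →
      (∀ n : ℕ, 1 ≤ n → 1 ≤ distinctPartsSum g n) ∧
        IsPIO (fun n => (distinctPartsSum g n : ℤ))) ∧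
    (∀ n : ℕ, 1 ≤ n → numDistinctCompositions n =
      ∑ k ∈ Finset.Icc 1 n, k.factorial * numDistinctPartitions k n) ∧
    IsPIO (fun n => (numDistinctCompositions n : ℤ)) := by
  have pos : ∀ g : ℕ → ℕ, (∀ k : ℕ, 1 ≤ k → 1 ≤ g k) →
      ∀ n : ℕ, 1 ≤ n → 1 ≤ distinctPartsSum g n := by
    intro g hg n hn
    rw [distinctPartsSum_eq_sum]
    -- The partition with the single part `n` already makes the sum positive.
    have hmem : {n} ∈ setsWithSum n := by simp [mem_setsWithSum, hn]
    exact (hg _ (by simp)).trans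
      (Finset.single_le_sum (f := fun s => g s.card) (fun _ _ => Nat.zero_le _) hmem)
  have hfact : ∀ k : ℕ, 1 ≤ k → 1 ≤ k.factorial := fun k _ => k.factorial_pos
  refine ⟨fun g hg h => ⟨pos g hg, isPIO_distinctPartsSum hg h (pos g hg)⟩, fun n hn => ?_, ?_⟩
  · rw [numDistinctCompositions_eq_distinctPartsSum, distinctPartsSum_eq_sum_Icc _ hn]
  · simp only [numDistinctCompositions_eq_distinctPartsSum]
    exact isPIO_distinctPartsSum hfact isPIO_factorial (pos _ hfact)
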